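/- Let $k$ be an algebraically closed field of characteristic zero, let $m$ be a positive integer, let $f=z(z+m)\in k[z]$, and let $\sigma$ be the automorphism of $k[z]$ with $\sigma(z)=z+1$. Let $A=A(f)$ be the generalized Weyl algebra generated over $k[z]$ by $x,y$ with relations $xz=\sigma(z)x$, $yz=\sigma^{-1}(z)y$, $xy=f$, $yx=\sigma^{-1}(f)$, which is $\mathbb Z$-graded by $\deg x=1$, $\deg y=-1$, $\deg z=0$. Let $\mathrm{gr}\,A$ be the category of finitely generated $\mathbb Z$-graded right $A$-modules with degree-preserving homomorphisms, let $\mathrm{fdim}\,A$ be its full subcategory of modules that are finite-dimensional over $k$, and let $\pi:\mathrm{gr}\,A\to \mathrm{qgr}\,A=\mathrm{gr}\,A/\mathrm{fdim}\,A$ be the quotient functor: the objects of $\mathrm{qgr}\,A$ are those of $\mathrm{gr}\,A$, and $$\mathrm{Hom}_{\mathrm{qgr}\,A}(\pi M,\pi N)=\varinjlim \mathrm{Hom}_{\mathrm{gr}\,A}(M',N/N'),$$ the limit running over all graded submodules $M'\subseteq M$ and $N'\subseteq N$ with $M/M'$ and $N'$ finite-dimensional. Let $P$ be a projective object of $\mathrm{gr}\,A$.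 Then among the graded submodules $D\subseteq P$ with $P/D$ finite-dimensional there is a smallest one, denoted $\kappa(P)$, and $\pi P$ is projective in $\mathrm{qgr}\,A$ if and only if $\kappa(P)=P$. -/

import Mathlib

open CategoryTheory Polynomial

universe u

/-- The generators `z`, `x`, `y` of the generalized Weyl algebra. -/
inductive GWAGen : Type
  | z | x | y

namespace GWAGen

/-- The degrees of the generators. -/
def deg : GWAGen → ℤ
  | z => 0
  | x => 1
  | y => -1

end GWAGen

section Algebra

variable {k : Type u} [Field k]

/-- The automorphism `σ` of `k[z]` with `σ(z) = z + 1`. -/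
noncomputable def gwaSigma (k : Type u) [Field k] : k[X] ≃ₐ[k] k[X] := algEquivAevalXAddC 1

/-- The generators of the free algebra `k⟨z, x, y⟩`. -/
noncomputable def gwaFree (k : Type u) [Field k] (g : GWAGen) : FreeAlgebra k GWAGen :=
  FreeAlgebra.ι k g

/-- The defining relations `xz = σ(z)x`, `yz = σ⁻¹(z)y`, `xy = f(z)`, `yx = σ⁻¹(f)(z)`. -/
inductive GWARel (f : k[X]) : FreeAlgebra k GWAGen → FreeAlgebra k GWAGen → Prop
  | xz : GWARel f (gwaFree k .x * gwaFree k .z)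
      (aeval (gwaFree k .z) (gwaSigma k X) * gwaFree k .x)
  | yz : GWARel f (gwaFree k .y * gwaFree k .z)
      (aeval (gwaFree k .z) ((gwaSigma k).symm X) * gwaFree k .y)
  | xy : GWARel f (gwaFree k .x * gwaFree k .y) (aeval (gwaFree k .z) f)
  | yx : GWARel f (gwaFree k .y * gwaFree k .x) (aeval (gwaFree k .z) ((gwaSigma k).symm f))

/-- The generalized Weyl algebra `A(f) = k[z](σ, f)`, presented by generators and relations. -/
def GWA (f : k[X]) : Type u := RingQuot (GWARel f)

namespace GWA

variable (f : k[X])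

noncomputable instance : Ring (GWA f) := inferInstanceAs (Ring (RingQuot (GWARel f)))
noncomputable instance : Algebra k (GWA f) := inferInstanceAs (Algebra k (RingQuot (GWARel f)))

/-- The quotient map `k⟨z, x, y⟩ → A(f)`. -/
noncomputable def mk : FreeAlgebra k GWAGen →ₐ[k] GWA f := RingQuot.mkAlgHom k (GWARel f)

/-- The images of the generators in `A(f)`. -/
noncomputable def gen (g : GWAGen) : GWA f := mk f (gwaFree k g)

/-- The homogeneous component `A(f)_n` for `deg x = 1`, `deg y = -1`, `deg z = 0`: the span of all
words of degree `n` in the generators. -/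
noncomputable def component (n : ℤ) : Submodule k (GWA f) :=
  Submodule.span k {a | ∃ w : List GWAGen, (w.map GWAGen.deg).sum = n ∧ (w.map (gen f)).prod = a}

lemma gen_mem (g : GWAGen) : gen f g ∈ component f g.deg :=
  Submodule.subset_span ⟨[g], by simp, by simp⟩

instance : SetLike.GradedMonoid (component f) where
  one_mem := Submodule.subset_span ⟨[], by simp, by simp⟩
  mul_mem := by
    intro i j a b ha hb
    have : component f i * component f j ≤ component f (i + j) := by
      rw [component, component, Submodule.span_mul_span]
      refine Submodule.span_le.2 ?_
      rintro _ ⟨_, ⟨v, rfl, rfl⟩, _, ⟨w, rfl, rfl⟩, rfl⟩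
      exact Submodule.subset_span ⟨v ++ w, by simp, by simp⟩
    exact this (Submodule.mul_mem_mul ha hb)

/-- The generators as homogeneous elements of `⨁ n, A(f)_n`. -/
noncomputable def hgen (g : GWAGen) : DirectSum ℤ fun i => component f i :=
  DirectSum.of (fun i => component f i) g.deg ⟨gen f g, gen_mem f g⟩

lemma of_congr {i j : ℤ} (a : component f i) (b : component f j) (h : i = j)
    (h' : (a : GWA f) = b) : DirectSum.of (fun i => component f i) i a =
      DirectSum.of (fun i => component f i) j b := by
  subst h
  rw [Subtype.ext h']

lemma aeval_mem (p : k[X]) : aeval (gen f .z) p ∈ component f 0 := by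
  rw [aeval_eq_sum_range]
  refine Submodule.sum_mem _ fun i _ => Submodule.smul_mem _ _ ?_
  exact Submodule.subset_span ⟨List.replicate i .z, by simp [GWAGen.deg], by simp⟩

lemma aeval_hgen (p : k[X]) : aeval (hgen f .z) p =
    DirectSum.of (fun i => component f i) 0 ⟨aeval (gen f .z) p, aeval_mem f p⟩ := by
  have hpow : ∀ n : ℕ, ∃ h, hgen f .z ^ n =
      DirectSum.of (fun i => component f i) 0 ⟨gen f .z ^ n, h⟩ := by
    intro n
    induction n with
    | zero => exact ⟨by simpa using aeval_mem f 1, of_congr f ⟨1, _⟩ _ rfl (pow_zero _).symm⟩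
    | succ n ih =>
      obtain ⟨h, e⟩ := ih
      refine ⟨by simpa using aeval_mem f (X ^ (n + 1)), ?_⟩
      rw [pow_succ, e, hgen, DirectSum.of_mul_of]
      exact of_congr f _ _ rfl (pow_succ _ _).symm
  induction p using Polynomial.induction_on' with
  | add p q hp hq =>
    rw [map_add, hp, hq, ← map_add]
    exact of_congr f _ _ rfl (map_add (aeval (gen f .z)) p q).symm
  | monomial n a =>
    obtain ⟨h, e⟩ := hpow n
    rw [aeval_monomial, ← Algebra.smul_def, e]
    refine ((DirectSum.lof k ℤ (fun i => component f i) 0).map_smul a _).symm.trans ?_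
    refine of_congr f _ _ rfl ?_
    change a • gen f .z ^ n = aeval (gen f .z) (monomial n a)
    rw [aeval_monomial, ← Algebra.smul_def]

lemma rel {a b : FreeAlgebra k GWAGen} (h : GWARel f a b) : mk f a = mk f b :=
  RingQuot.mkAlgHom_rel k h

lemma mk_aeval (p : k[X]) : mk f (aeval (gwaFree k .z) p) = aeval (gen f .z) p :=
  (Polynomial.aeval_algHom_apply (mk f) _ p).symm

/-- The decomposition into homogeneous components, as an algebra map. -/
noncomputable def decomp : GWA f →ₐ[k] DirectSum ℤ fun i => component f i :=
  RingQuot.liftAlgHom k ⟨FreeAlgebra.lift k (hgen f), by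
    have h1 : ∀ g, FreeAlgebra.lift k (hgen f) (gwaFree k g) = hgen f g := fun g => by
      simp [gwaFree]
    have h2 : ∀ p : k[X], FreeAlgebra.lift k (hgen f) (aeval (gwaFree k .z) p) =
        aeval (hgen f .z) p := fun p => by
      rw [← Polynomial.aeval_algHom_apply, h1]
    intro a b h
    have hr := rel f h
    cases h <;> simp only [map_mul, h1, h2, mk_aeval, aeval_hgen] at hr ⊢ <;>
      (try unfold hgen) <;> simp only [DirectSum.of_mul_of]
    all_goals exact of_congr f _ _ (by rfl) hr⟩

lemma decomp_gen (g : GWAGen) : decomp f (gen f g) = hgen f g := by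
  have : decomp f (mk f (gwaFree k g)) = FreeAlgebra.lift k (hgen f) (gwaFree k g) :=
    RingQuot.liftAlgHom_mkAlgHom_apply ..
  exact this.trans (by simp [gwaFree])

/-- `A(f)` is a `ℤ`-graded algebra. -/
noncomputable instance : GradedAlgebra (component f) :=
  GradedAlgebra.ofAlgHom (component f) (decomp f)
    (by
      refine RingQuot.ringQuot_ext' k _ _ ?_
      refine FreeAlgebra.hom_ext (funext fun g => ?_)
      change DirectSum.coeAlgHom (component f) (decomp f (gen f g)) = gen f g
      rw [decomp_gen, hgen, DirectSum.coeAlgHom_of])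
    (by
      have key : ∀ w : List GWAGen, ∀ h : (w.map (gen f)).prod ∈ component f (w.map GWAGen.deg).sum,
          decomp f (w.map (gen f)).prod =
          DirectSum.of (fun i => component f i) (w.map GWAGen.deg).sum ⟨(w.map (gen f)).prod, h⟩ := by
        intro w
        induction w with
        | nil => intro h; simp only [List.map_nil, List.prod_nil, map_one]; rfl
        | cons g w ih =>
          intro h
          simp only [List.map_cons, List.prod_cons, map_mul, decomp_gen, hgen]
          rw [ih (Submodule.subset_span ⟨w, rfl, rfl⟩), DirectSum.of_mul_of]
          exact of_congr f _ _ (by simp) rfl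
      rintro i ⟨a, ha⟩
      change decomp f a = _
      have hlin : ∀ a (ha : a ∈ component f i), decomp f a = DirectSum.lof k ℤ
          (fun i => component f i) i ⟨a, ha⟩ := by
        intro a ha
        induction ha using Submodule.span_induction with
        | mem a h => obtain ⟨w, rfl, rfl⟩ := h; exact key w _
        | zero => rw [map_zero]; exact (map_zero _).symm
        | add a b ha hb iha ihb => rw [map_add, iha, ihb, ← map_add]; rfl
        | smul c a ha iha => rw [map_smul, iha, ← map_smul]; rfl
      exact hlin a ha)

end GWA
end Algebra

section Graded

variable {k : Type u} [Field k] {R : Type u} [Ring R] [Algebra k R] 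
variable {𝒜 : ℤ → Submodule k R}

/-- The objects of `gr R`: finitely generated `ℤ`-graded right modules over a graded `k`-algebra
`R = ⨁ n, 𝒜 n`. Right modules are modules over `Rᵐᵒᵖ`; the `k`-structure is the one induced by
`R`. -/
structure GrMod (𝒜 : ℤ → Submodule k R) where
  carrier : Type u
  [addCommGroup : AddCommGroup carrier]
  [moduleBase : Module k carrier]
  [module : Module Rᵐᵒᵖ carrier]
  [isScalarTower : IsScalarTower k Rᵐᵒᵖ carrier]
  component : ℤ → Submodule k carrier
  [decomposition : DirectSum.Decomposition component]
  smul_mem : ∀ {i j : ℤ} {m : carrier} {a : R}, m ∈ component i → a ∈ 𝒜 j →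
    MulOpposite.op a • m ∈ component (i + j)
  finite : Module.Finite Rᵐᵒᵖ carrier

namespace GrMod

instance (𝒜 : ℤ → Submodule k R) : CoeSort (GrMod 𝒜) (Type u) := ⟨carrier⟩

attribute [instance] addCommGroup moduleBase module isScalarTower decomposition

variable {𝒜 : ℤ → Submodule k R}

/-- The morphisms of `gr R`: `R`-linear maps that preserve degrees. -/
@[ext]
structure Hom (M N : GrMod 𝒜) where
  toLinearMap : M →ₗ[Rᵐᵒᵖ] N
  map_mem : ∀ (i : ℤ) (m : M), m ∈ M.component i → toLinearMap m ∈ N.component i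

/-- The category `gr R`. -/
instance : Category (GrMod 𝒜) where
  Hom := Hom
  id M := ⟨LinearMap.id, fun _ _ h => h⟩
  comp f g := ⟨g.toLinearMap ∘ₗ f.toLinearMap, fun i m h => g.map_mem i _ (f.map_mem i m h)⟩

/-- The graded submodules `D` of `M` with `M / D` in `fdim`, the full subcategory of
finite-dimensional modules. -/
def cofinite (M : GrMod 𝒜) : Set (Submodule Rᵐᵒᵖ M) :=
  {D | D.IsHomogeneous M.component ∧ Module.Finite k (M ⧸ D)}

/-- The finite-dimensional graded submodules of `M`. -/
def torsion (M : GrMod 𝒜) : Set (Submodule Rᵐᵒᵖ M) :=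
  {T | T.IsHomogeneous M.component ∧ Module.Finite k T}

/-- `κ(M)`, the smallest graded submodule with finite-dimensional quotient. It is defined as the
infimum of all of them; that the infimum belongs to `M.cofinite` is a fact to be proved. -/
def kappa (M : GrMod 𝒜) : Submodule Rᵐᵒᵖ M := sInf M.cofinite

end GrMod

open GrMod


namespace GrMod

lemma IsHomogeneous.inf {M : GrMod 𝒜} {D E : Submodule Rᵐᵒᵖ M} (hD : D.IsHomogeneous M.component)
    (hE : E.IsHomogeneous M.component) : (D ⊓ E).IsHomogeneous M.component :=
  fun i _ hm => ⟨hD i hm.1, hE i hm.2⟩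

lemma IsHomogeneous.sup {M : GrMod 𝒜} {D E : Submodule Rᵐᵒᵖ M} (hD : D.IsHomogeneous M.component)
    (hE : E.IsHomogeneous M.component) : (D ⊔ E).IsHomogeneous M.component := by
  intro i m hm
  obtain ⟨a, ha, b, hb, rfl⟩ := Submodule.mem_sup.1 hm
  rw [DirectSum.decompose_add]
  exact Submodule.add_mem_sup (hD i ha) (hE i hb)

lemma finite_quotient_of_ker_le {M : GrMod 𝒜} {D D' : Submodule Rᵐᵒᵖ M}
    (V : Type u) [AddCommGroup V] [Module Rᵐᵒᵖ V] [Module k V] [IsScalarTower k Rᵐᵒᵖ V]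
    [Module.Finite k V] (hD : Module.Finite k (M ⧸ D)) (g : D →ₗ[Rᵐᵒᵖ] V)
    (hg : ∀ m : D, g m = 0 → (m : M) ∈ D') : Module.Finite k (M ⧸ D') := by
  obtain ⟨e, he⟩ := LinearMap.exists_extend (p := D.restrictScalars k) (g.restrictScalars k)
  let F : M →ₗ[k] (M ⧸ D) × V := (D.mkQ.restrictScalars k).prod e
  have hF : LinearMap.ker F ≤ LinearMap.ker (D'.mkQ.restrictScalars k) := by
    intro m hm
    have h1 : D.mkQ m = 0 := congrArg Prod.fst hm
    have h2 : e m = 0 := congrArg Prod.snd hm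
    have hmD : m ∈ D := (Submodule.Quotient.mk_eq_zero _).1 h1
    exact (Submodule.Quotient.mk_eq_zero _).2
      (hg ⟨m, hmD⟩ ((LinearMap.congr_fun he ⟨m, hmD⟩).symm.trans h2))
  have hfin : Module.Finite k (M ⧸ LinearMap.ker F) :=
    Module.Finite.equiv F.quotKerEquivRange.symm
  refine Module.Finite.of_surjective ((LinearMap.ker F).liftQ (D'.mkQ.restrictScalars k) hF) ?_
  intro y
  obtain ⟨m, rfl⟩ := D'.mkQ_surjective y
  exact ⟨Submodule.Quotient.mk m, rfl⟩

lemma cofinite_inf {M : GrMod 𝒜} {D E : Submodule Rᵐᵒᵖ M} (hD : D ∈ M.cofinite)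
    (hE : E ∈ M.cofinite) : D ⊓ E ∈ M.cofinite := by
  refine ⟨IsHomogeneous.inf hD.1 hE.1, ?_⟩
  have := hD.2
  have := hE.2
  let g : M →ₗ[Rᵐᵒᵖ] (M ⧸ D) × (M ⧸ E) := D.mkQ.prod E.mkQ
  have hg : LinearMap.ker g = D ⊓ E := by simp [g, LinearMap.ker_prod]
  let g' : (M ⧸ D ⊓ E) →ₗ[Rᵐᵒᵖ] (M ⧸ D) × (M ⧸ E) := (D ⊓ E).liftQ g hg.ge
  have hinj : Function.Injective g' := by
    rw [← LinearMap.ker_eq_bot]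
    exact Submodule.ker_liftQ_eq_bot _ _ _ hg.le
  exact Module.Finite.of_injective (g'.restrictScalars k) hinj

lemma torsion_sup {M : GrMod 𝒜} {D E : Submodule Rᵐᵒᵖ M} (hD : D ∈ M.torsion)
    (hE : E ∈ M.torsion) : D ⊔ E ∈ M.torsion := by
  refine ⟨IsHomogeneous.sup hD.1 hE.1, ?_⟩
  have := hD.2
  have := hE.2
  have h : ((D.restrictScalars k) ⊔ (E.restrictScalars k)) = (D ⊔ E).restrictScalars k :=
    (Submodule.restrictScalars_sup ..).symm
  have h1 : Module.Finite k (D.restrictScalars k) := hD.2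
  have h2 : Module.Finite k (E.restrictScalars k) := hE.2
  have : Module.Finite k ((D.restrictScalars k) ⊔ (E.restrictScalars k) : Submodule k M) :=
    inferInstance
  rw [h] at this
  exact this

lemma top_mem_cofinite (M : GrMod 𝒜) : ⊤ ∈ M.cofinite :=
  ⟨fun _ _ _ => trivial, inferInstance⟩

lemma bot_mem_torsion (M : GrMod 𝒜) : ⊥ ∈ M.torsion :=
  ⟨fun i m hm => by rw [(Submodule.mem_bot _).1 hm]; simp, inferInstance⟩

end GrMod

/-- The index set of the direct limit that defines `Hom(πM, πN)`: pairs of a graded submodule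
`M' ⊆ M` with `M / M'` finite-dimensional and a finite-dimensional graded submodule `N' ⊆ N`.
(Over a right noetherian `R` such an `M'` is finitely generated, hence a subobject in `gr R`.) -/
structure QIndex (M N : GrMod 𝒜) where
  dom : Submodule Rᵐᵒᵖ M
  tor : Submodule Rᵐᵒᵖ N
  dom_mem : dom ∈ M.cofinite
  tor_mem : tor ∈ N.torsion

/-- A representative of a morphism `πM ⟶ πN`: a degree-preserving map `M' → N / N'`, where
`(N / N')_i` is the image of `N_i`. -/
structure QPreHom (M N : GrMod 𝒜) extends QIndex M N where
  map : dom →ₗ[Rᵐᵒᵖ] N ⧸ tor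
  map_mem : ∀ (i : ℤ) (m : dom), (m : M) ∈ M.component i → ∃ n ∈ N.component i, map m = tor.mkQ n

/-- `(M', N') ≤ (M'', N'')` when `M'' ⊆ M'` and `N' ⊆ N''`. -/
instance QIndex.instLE (M N : GrMod 𝒜) : LE (QIndex M N) :=
  ⟨fun a b => b.dom ≤ a.dom ∧ a.tor ≤ b.tor⟩

namespace QPreHom

variable {M N L K : GrMod 𝒜}

/-- Equality in the direct limit: two representatives agree as maps `M'' → N / N''` for some later
index `(M'', N'')`. -/
def Equivalent (φ ψ : QPreHom M N) : Prop :=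
  ∃ (j : QIndex M N) (h₁ : φ.toQIndex ≤ j) (h₂ : ψ.toQIndex ≤ j), ∀ (m : M) (hm : m ∈ j.dom),
    Submodule.factor h₁.2 (φ.map ⟨m, h₁.1 hm⟩) = Submodule.factor h₂.2 (ψ.map ⟨m, h₂.1 hm⟩)

/-- `n` represents the image of `m`. -/
def Rel (φ : QPreHom M N) (m : M) (n : N) : Prop :=
  ∃ h : m ∈ φ.dom, φ.map ⟨m, h⟩ = φ.tor.mkQ n

lemma exists_rel (φ : QPreHom M N) {m : M} (h : m ∈ φ.dom) : ∃ n, φ.Rel m n := by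
  obtain ⟨n, hn⟩ := φ.tor.mkQ_surjective (φ.map ⟨m, h⟩)
  exact ⟨n, h, hn.symm⟩

lemma Rel.mem_dom {φ : QPreHom M N} {m n} (h : φ.Rel m n) : m ∈ φ.dom := h.1

lemma Rel.sub {φ : QPreHom M N} {m m' n n'} (h : φ.Rel m n) (h' : φ.Rel m' n') :
    φ.Rel (m - m') (n - n') := by
  obtain ⟨h, e⟩ := h
  obtain ⟨h', e'⟩ := h'
  refine ⟨sub_mem h h', ?_⟩
  rw [map_sub, ← e, ← e', ← map_sub]
  rfl

lemma Rel.sub_mem {φ : QPreHom M N} {m n n'} (h : φ.Rel m n) (h' : φ.Rel m n') :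
    n - n' ∈ φ.tor := by
  obtain ⟨h, e⟩ := h
  obtain ⟨h', e'⟩ := h'
  exact (Submodule.Quotient.eq _).1 (e.symm.trans e')

lemma Rel.of_sub_mem {φ : QPreHom M N} {m n n'} (h : φ.Rel m n) (h' : n - n' ∈ φ.tor) :
    φ.Rel m n' := by
  obtain ⟨h, e⟩ := h
  exact ⟨h, e.trans ((Submodule.Quotient.eq _).2 h')⟩

lemma Rel.proj {φ : QPreHom M N} {m n} (h : φ.Rel m n) (i : ℤ) :
    φ.Rel (DirectSum.decompose M.component m i) (DirectSum.decompose N.component n i) := by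
  classical
  obtain ⟨hm, e⟩ := h
  have hD : ∀ j, (DirectSum.decompose M.component m j : M) ∈ φ.dom := fun j => φ.dom_mem.1 j hm
  choose c hc hcm using fun j => φ.map_mem j ⟨_, hD j⟩ (SetLike.coe_mem _)
  set s := (DirectSum.decompose M.component m).support ∪ {i} with hs
  have hsum : (⟨m, hm⟩ : φ.dom) = ∑ j ∈ s, ⟨_, hD j⟩ := by
    apply Subtype.ext
    rw [AddSubmonoidClass.coe_finsetSum]
    change m = ∑ j ∈ s, (DirectSum.decompose M.component m j : M)
    conv_lhs => rw [← DirectSum.sum_support_decompose M.component m]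
    refine Finset.sum_subset Finset.subset_union_left fun j _ hj => ?_
    simpa using hj
  have hmem : n - ∑ j ∈ s, c j ∈ φ.tor := by
    rw [← Submodule.Quotient.eq]
    change φ.tor.mkQ n = φ.tor.mkQ _
    rw [← e, hsum, map_sum, map_sum]
    exact Finset.sum_congr rfl fun j _ => hcm j
  have hci : (DirectSum.decompose N.component (∑ j ∈ s, c j) i : N) = c i := by
    rw [DirectSum.decompose_sum, DFinsupp.finsetSum_apply, AddSubmonoidClass.coe_finsetSum,
      Finset.sum_eq_single i]
    · exact DirectSum.decompose_of_mem_same _ (hc i)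
    · intro j _ hj
      exact DirectSum.decompose_of_mem_ne _ (hc j) hj
    · intro h
      exact absurd (by simp [hs]) h
  have := φ.tor_mem.1 i hmem
  rw [DirectSum.decompose_sub, DirectSum.sub_apply, AddSubgroupClass.coe_sub, hci] at this
  refine ⟨hD i, (hcm i).trans ?_⟩
  exact ((Submodule.Quotient.eq _).2 this).symm

lemma equivalent_of {φ ψ : QPreHom M N} (D : Submodule Rᵐᵒᵖ M) (T : Submodule Rᵐᵒᵖ N)
    (hD : D ∈ M.cofinite) (hT : T ∈ N.torsion)
    (h : ∀ m ∈ D, ∃ n n', φ.Rel m n ∧ ψ.Rel m n' ∧ n - n' ∈ T) : φ.Equivalent ψ := by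
  refine ⟨⟨D, T ⊔ (φ.tor ⊔ ψ.tor), hD, torsion_sup hT (torsion_sup φ.tor_mem ψ.tor_mem)⟩,
    ⟨fun m hm => ?_, le_sup_left.trans le_sup_right⟩,
    ⟨fun m hm => ?_, le_sup_right.trans le_sup_right⟩, fun m hm => ?_⟩
  · obtain ⟨n, n', h₁, -, -⟩ := h m hm
    exact h₁.1
  · obtain ⟨n, n', -, h₁, -⟩ := h m hm
    exact h₁.1
  · obtain ⟨n, n', ⟨h₁, e₁⟩, ⟨h₂, e₂⟩, h₃⟩ := h m hm
    rw [e₁, e₂]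
    exact (Submodule.Quotient.eq _).2 (Submodule.mem_sup_left h₃)

lemma Equivalent.exists_rel {φ ψ : QPreHom M N} (h : φ.Equivalent ψ) :
    ∃ D ∈ M.cofinite, ∃ T ∈ N.torsion, 
      ∀ m ∈ D, ∃ n n', φ.Rel m n ∧ ψ.Rel m n' ∧ n - n' ∈ T := by
  obtain ⟨j, h₁, h₂, h⟩ := h
  refine ⟨j.dom, j.dom_mem, j.tor, j.tor_mem, fun m hm => ?_⟩
  obtain ⟨n, hn⟩ := φ.exists_rel (h₁.1 hm)
  obtain ⟨n', hn'⟩ := ψ.exists_rel (h₂.1 hm)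
  have := h m hm
  rw [hn.2, hn'.2] at this
  exact ⟨n, n', hn, hn', (Submodule.Quotient.eq _).1 this⟩

/-- The direct limit `Hom(πM, πN)` is the quotient by this equivalence relation. -/
instance setoid (M N : GrMod 𝒜) : Setoid (QPreHom M N) where
  r := Equivalent
  iseqv :=
    { refl := fun φ => ⟨φ.toQIndex, ⟨le_rfl, le_rfl⟩, ⟨le_rfl, le_rfl⟩, fun _ _ => rfl⟩
      symm := fun ⟨j, h₁, h₂, h⟩ => ⟨j, h₂, h₁, fun m hm => (h m hm).symm⟩
      trans := fun {φ ψ χ} h h' => by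
        obtain ⟨D, hD, T, hT, h⟩ := h.exists_rel
        obtain ⟨D', hD', T', hT', h'⟩ := h'.exists_rel
        refine equivalent_of (D ⊓ D') ((T ⊔ T') ⊔ ψ.tor) (cofinite_inf hD hD')
          (torsion_sup (torsion_sup hT hT') ψ.tor_mem) fun m hm => ?_
        obtain ⟨n, n', h₁, h₂, h₃⟩ := h m hm.1
        obtain ⟨p, p', h₄, h₅, h₆⟩ := h' m hm.2
        refine ⟨n, p', h₁, h₅, ?_⟩
        have : n - p' = (n - n') + (p - p') + (n' - p) := by abel
        rw [this]
        exact Submodule.add_mem_sup (Submodule.add_mem_sup h₃ h₆) (h₂.sub_mem h₄) }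

/-- The representative with `M' = M` and `N' = 0` given by a morphism of `gr R`. -/
def ofHom (f : M ⟶ N) : QPreHom M N where
  dom := ⊤
  tor := ⊥
  dom_mem := top_mem_cofinite M
  tor_mem := bot_mem_torsion N
  map := (⊥ : Submodule Rᵐᵒᵖ N).mkQ ∘ₗ f.toLinearMap ∘ₗ (⊤ : Submodule Rᵐᵒᵖ M).subtype
  map_mem i m hm := ⟨_, f.map_mem i m hm, rfl⟩

lemma ofHom_rel (f : M ⟶ N) (m : M) : (ofHom f).Rel m (f.toLinearMap m) := ⟨trivial, rfl⟩

lemma rel_ofHom {f : M ⟶ N} {m : M} {n : N} (h : (ofHom f).Rel m n) : n = f.toLinearMap m :=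
  sub_eq_zero.1 ((Submodule.mem_bot _).1 (h.sub_mem (ofHom_rel f m)))

section comp

variable (φ : QPreHom M N) (ψ : QPreHom N L)

/-- The map `ψ.dom → N / φ.tor` induced by the identity of `N`. -/
def quotMap : ψ.dom →ₗ[Rᵐᵒᵖ] N ⧸ φ.tor := φ.tor.mkQ ∘ₗ ψ.dom.subtype

/-- The domain of the composite: the preimage under `φ : M' → N / N'` of the image of
`ψ.dom`. -/
def compDom : Submodule Rᵐᵒᵖ M :=
  (Submodule.comap φ.map (LinearMap.range (quotMap φ ψ))).map φ.dom.subtype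

/-- The submodule of `L` to be divided out in the composite: the preimage in `L` of
`ψ (ψ.dom ∩ N')`. -/
def compTor : Submodule Rᵐᵒᵖ L :=
  Submodule.comap ψ.tor.mkQ ((LinearMap.ker (quotMap φ ψ)).map ψ.map)

lemma mem_compDom {m : M} : m ∈ compDom φ ψ ↔ ∃ n ∈ ψ.dom, φ.Rel m n := by
  constructor
  · rintro ⟨⟨m, hm⟩, ⟨n, hn⟩, rfl⟩
    exact ⟨n, n.2, hm, hn.symm⟩
  · rintro ⟨n, hn, hm, e⟩
    exact ⟨⟨m, hm⟩, ⟨⟨n, hn⟩, e.symm⟩, rfl⟩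

lemma mem_compTor {l : L} : l ∈ compTor φ ψ ↔ ∃ n ∈ φ.tor, ψ.Rel n l := by
  constructor
  · rintro ⟨⟨n, hn⟩, h, e⟩
    exact ⟨n, (Submodule.Quotient.mk_eq_zero _).1 h, hn, e⟩
  · rintro ⟨n, hn, hm, e⟩
    exact ⟨⟨n, hm⟩, (Submodule.Quotient.mk_eq_zero _).2 hn, e⟩

lemma tor_le_compTor : ψ.tor ≤ compTor φ ψ := fun l hl =>
  (mem_compTor φ ψ).2 ⟨0, zero_mem _, zero_mem _, by
    rw [show (⟨0, zero_mem _⟩ : ψ.dom) = 0 from rfl, map_zero]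
    exact ((Submodule.Quotient.mk_eq_zero _).2 hl).symm⟩

lemma compDom_mem : compDom φ ψ ∈ M.cofinite := by
  refine ⟨fun i m hm => ?_, ?_⟩
  · obtain ⟨n, hn, h⟩ := (mem_compDom φ ψ).1 hm
    exact (mem_compDom φ ψ).2 ⟨_, ψ.dom_mem.1 i hn, h.proj i⟩
  · have := ψ.dom_mem.2
    let p : N →ₗ[Rᵐᵒᵖ] (N ⧸ φ.tor) ⧸ LinearMap.range (quotMap φ ψ) :=
      (LinearMap.range (quotMap φ ψ)).mkQ ∘ₗ φ.tor.mkQ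
    have hp : ψ.dom ≤ LinearMap.ker p := fun n hn =>
      (Submodule.Quotient.mk_eq_zero _).2 ⟨⟨n, hn⟩, rfl⟩
    have hs : Function.Surjective (ψ.dom.liftQ p hp) := by
      intro y
      obtain ⟨y, rfl⟩ := Submodule.mkQ_surjective _ y
      obtain ⟨n, rfl⟩ := Submodule.mkQ_surjective _ y
      exact ⟨Submodule.Quotient.mk n, rfl⟩
    have : Module.Finite k ((N ⧸ φ.tor) ⧸ LinearMap.range (quotMap φ ψ)) :=
      Module.Finite.of_surjective ((ψ.dom.liftQ p hp).restrictScalars k) hs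
    refine finite_quotient_of_ker_le _ φ.dom_mem.2
      ((LinearMap.range (quotMap φ ψ)).mkQ ∘ₗ φ.map) fun m hm => ?_
    have hm' : φ.map m ∈ LinearMap.range (quotMap φ ψ) := (Submodule.Quotient.mk_eq_zero _).1 hm
    exact ⟨m, hm', rfl⟩

lemma compTor_mem : compTor φ ψ ∈ L.torsion := by
  refine ⟨fun i l hl => ?_, ?_⟩
  · obtain ⟨n, hn, h⟩ := (mem_compTor φ ψ).1 hl
    exact (mem_compTor φ ψ).2 ⟨_, φ.tor_mem.1 i hn, h.proj i⟩
  · have := φ.tor_mem.2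
    have hS := ψ.tor_mem.2
    let ι : LinearMap.ker (quotMap φ ψ) →ₗ[Rᵐᵒᵖ] φ.tor :=
      (ψ.dom.subtype ∘ₗ (LinearMap.ker (quotMap φ ψ)).subtype).codRestrict φ.tor
        fun n => (Submodule.Quotient.mk_eq_zero _).1 n.2
    have hι : Function.Injective ι := fun a b h =>
      Subtype.ext (Subtype.ext (congrArg (fun v : φ.tor => (v : N)) h))
    have hk : Module.Finite k (LinearMap.ker (quotMap φ ψ)) :=
      Module.Finite.of_injective (ι.restrictScalars k) hι
    have : ((compTor φ ψ).restrictScalars k).FG := by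
      refine Submodule.fg_of_fg_map_of_fg_inf_ker (ψ.tor.mkQ.restrictScalars k) ?_ ?_
      · have h : ((LinearMap.ker (quotMap φ ψ)).restrictScalars k).FG := Module.Finite.iff_fg.1 hk
        convert! h.map (ψ.map.restrictScalars k) using 1
        exact SetLike.coe_injective (Set.image_preimage_eq
          ((LinearMap.ker (quotMap φ ψ)).map ψ.map : Set (L ⧸ ψ.tor)) ψ.tor.mkQ_surjective)
      · have h : (ψ.tor.restrictScalars k).FG := Module.Finite.iff_fg.1 hS
        convert! h using 1
        ext l
        exact ⟨fun hl => (Submodule.Quotient.mk_eq_zero _).1 hl.2,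
          fun hl => ⟨tor_le_compTor φ ψ hl, (Submodule.Quotient.mk_eq_zero _).2 hl⟩⟩
    exact Module.Finite.iff_fg.2 this

lemma ker_quotMap_le : LinearMap.ker (quotMap φ ψ) ≤
    LinearMap.ker (Submodule.factor (tor_le_compTor φ ψ) ∘ₗ ψ.map) := fun n hn => by
  obtain ⟨l, hl⟩ := ψ.exists_rel n.2
  have hl' : ψ.map n = ψ.tor.mkQ l := hl.2
  rw [LinearMap.mem_ker, LinearMap.comp_apply, hl']
  exact (Submodule.Quotient.mk_eq_zero _).2 ((mem_compTor φ ψ).2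
    ⟨n, (Submodule.Quotient.mk_eq_zero _).1 hn, hl⟩)

/-- The underlying map of the composite. -/
noncomputable def compMap : compDom φ ψ →ₗ[Rᵐᵒᵖ] L ⧸ compTor φ ψ :=
  (LinearMap.ker (quotMap φ ψ)).liftQ (Submodule.factor (tor_le_compTor φ ψ) ∘ₗ ψ.map)
      (ker_quotMap_le φ ψ) ∘ₗ
    (quotMap φ ψ).quotKerEquivRange.symm.toLinearMap ∘ₗ
    (φ.map ∘ₗ Submodule.inclusion (Submodule.map_subtype_le _ _)).codRestrict
      (LinearMap.range (quotMap φ ψ)) (fun m => by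
        obtain ⟨n, hn, h, e⟩ := (mem_compDom φ ψ).1 m.2
        exact ⟨⟨n, hn⟩, e.symm⟩)

lemma compMap_apply {m : M} (hm : m ∈ compDom φ ψ) {n : N} {l : L} (h₁ : φ.Rel m n)
    (h₂ : ψ.Rel n l) : compMap φ ψ ⟨m, hm⟩ = (compTor φ ψ).mkQ l := by
  obtain ⟨h, e⟩ := h₁
  obtain ⟨h', e'⟩ := h₂
  have : (⟨φ.map ⟨m, h⟩, ⟨⟨n, h'⟩, e.symm⟩⟩ : LinearMap.range (quotMap φ ψ)) =
      (quotMap φ ψ).quotKerEquivRange (Submodule.Quotient.mk ⟨n, h'⟩) := Subtype.ext e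
  change (LinearMap.ker (quotMap φ ψ)).liftQ _ (ker_quotMap_le φ ψ) ((quotMap φ ψ).quotKerEquivRange.symm
    ⟨φ.map ⟨m, h⟩, _⟩) = _
  rw [this, LinearEquiv.symm_apply_apply, Submodule.liftQ_apply, LinearMap.comp_apply, e']
  rfl

/-- Composition of representatives: `m ↦ ψ n` for any `n` in the domain of `ψ` that represents
`φ m`. -/
noncomputable def comp : QPreHom M L where
  dom := compDom φ ψ
  tor := compTor φ ψ
  dom_mem := compDom_mem φ ψ
  tor_mem := compTor_mem φ ψ
  map := compMap φ ψ
  map_mem := by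
    rintro i ⟨m, hm⟩ hmi
    obtain ⟨n, hn, h⟩ := (mem_compDom φ ψ).1 hm
    have h' := h.proj i
    rw [DirectSum.decompose_of_mem_same _ hmi] at h'
    have hn' := ψ.dom_mem.1 i hn
    obtain ⟨l, hl, e⟩ := ψ.map_mem i ⟨_, hn'⟩ (SetLike.coe_mem _)
    exact ⟨l, hl, compMap_apply φ ψ hm h' ⟨hn', e⟩⟩

variable {φ ψ}

lemma comp_rel {m : M} {n : N} {l : L} (h₁ : φ.Rel m n) (h₂ : ψ.Rel n l) :
    (φ.comp ψ).Rel m l :=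
  ⟨(mem_compDom φ ψ).2 ⟨n, h₂.1, h₁⟩, compMap_apply φ ψ _ h₁ h₂⟩

lemma comp_equivalent_left {φ' : QPreHom M N} (h : φ.Equivalent φ') :
    (φ.comp ψ).Equivalent (φ'.comp ψ) := by
  obtain ⟨D, hD, T, hT, h⟩ := h.exists_rel
  -- the trivial map on `N` with indeterminacy `T`, used to enlarge the torsion submodule
  let θ : QPreHom M N :=
    { dom := ⊤, tor := T ⊔ (φ.tor ⊔ φ'.tor), dom_mem := top_mem_cofinite M
      tor_mem := torsion_sup hT (torsion_sup φ.tor_mem φ'.tor_mem), map := 0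
      map_mem := fun i m _ => ⟨0, zero_mem _, by simp⟩ }
  refine equivalent_of (D ⊓ (compDom φ ψ ⊓ compDom φ' ψ)) (compTor θ ψ)
    (cofinite_inf hD (cofinite_inf (compDom_mem _ _) (compDom_mem _ _))) (compTor_mem _ _)
    fun m hm => ?_
  obtain ⟨a, a', h₁, h₂, h₃⟩ := h m hm.1
  obtain ⟨n, hn, h₄⟩ := (mem_compDom φ ψ).1 hm.2.1
  obtain ⟨n', hn', h₅⟩ := (mem_compDom φ' ψ).1 hm.2.2
  obtain ⟨l, hl⟩ := ψ.exists_rel hn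
  obtain ⟨l', hl'⟩ := ψ.exists_rel hn'
  refine ⟨l, l', comp_rel h₄ hl, comp_rel h₅ hl', (mem_compTor θ ψ).2 ⟨n - n', ?_, hl.sub hl'⟩⟩
  have : n - n' = (a - a') + ((n - a) + (a' - n')) := by abel
  rw [this]
  exact Submodule.add_mem_sup h₃ (Submodule.add_mem_sup (h₄.sub_mem h₁) (h₂.sub_mem h₅))

lemma comp_equivalent_right {ψ' : QPreHom N L} (h : ψ.Equivalent ψ') :
    (φ.comp ψ).Equivalent (φ.comp ψ') := by
  obtain ⟨E, hE, S, hS, h⟩ := h.exists_rel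
  -- the zero map on `E`, used to shrink the domain
  let θ : QPreHom N L :=
    { dom := E, tor := ⊥, dom_mem := hE, tor_mem := bot_mem_torsion L, map := 0
      map_mem := fun i m _ => ⟨0, zero_mem _, by simp⟩ }
  refine equivalent_of (compDom φ θ) ((compTor φ ψ ⊔ compTor φ ψ') ⊔ S) (compDom_mem _ _)
    (torsion_sup (torsion_sup (compTor_mem _ _) (compTor_mem _ _)) hS) fun m hm => ?_
  obtain ⟨n, hn, h₁⟩ := (mem_compDom φ θ).1 hm
  obtain ⟨l, l', h₂, h₃, h₄⟩ := h n hn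
  exact ⟨l, l', comp_rel h₁ h₂, comp_rel h₁ h₃, Submodule.mem_sup_right h₄⟩

lemma comp_assoc_equivalent (χ : QPreHom L K) :
    ((φ.comp ψ).comp χ).Equivalent (φ.comp (ψ.comp χ)) := by
  refine equivalent_of _ ⊥ (compDom_mem (φ.comp ψ) χ) (bot_mem_torsion K) fun m hm => ?_
  obtain ⟨l', hl', h⟩ := (mem_compDom (φ.comp ψ) χ).1 hm
  obtain ⟨n, hn, h₁⟩ := (mem_compDom φ ψ).1 h.1
  obtain ⟨l, h₂⟩ := ψ.exists_rel hn
  obtain ⟨t, ht, h₃⟩ := (mem_compTor φ ψ).1 ((comp_rel h₁ h₂).sub_mem h)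
  obtain ⟨p, hp⟩ := χ.exists_rel hl'
  have h₄ : ψ.Rel (n - t) l' := by simpa using h₂.sub h₃
  have h₅ : φ.Rel m (n - t) := h₁.of_sub_mem (by simpa using ht)
  exact ⟨p, p, comp_rel h hp, comp_rel h₅ (comp_rel h₄ hp), by simp⟩

end comp

end QPreHom

open QPreHom

/-- The objects of `qgr R = gr R / fdim R`, which are those of `gr R`. -/
structure QGr (𝒜 : ℤ → Submodule k R) where
  of : GrMod 𝒜

namespace QGr

/-- The quotient category `qgr R` with `Hom(πM, πN) = colim Hom_gr(M', N / N')`. -/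
noncomputable instance : Category (QGr 𝒜) where
  Hom M N := Quotient (QPreHom.setoid M.of N.of)
  id M := ⟦ofHom (𝟙 M.of)⟧
  comp := Quotient.map₂ QPreHom.comp fun _ _ h₁ _ _ h₂ =>
    Setoid.trans (comp_equivalent_left h₁) (comp_equivalent_right h₂)
  id_comp := by
    rintro M N ⟨φ⟩
    refine Quotient.sound (equivalent_of φ.dom ⊥ φ.dom_mem (bot_mem_torsion _) fun m hm => ?_)
    obtain ⟨n, hn⟩ := φ.exists_rel hm
    exact ⟨n, n, comp_rel (ofHom_rel _ m) hn, hn, by simp⟩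
  comp_id := by
    rintro M N ⟨φ⟩
    refine Quotient.sound (equivalent_of φ.dom ⊥ φ.dom_mem (bot_mem_torsion _) fun m hm => ?_)
    obtain ⟨n, hn⟩ := φ.exists_rel hm
    exact ⟨n, n, comp_rel hn (ofHom_rel _ n), hn, by simp⟩
  assoc := by
    rintro M N L K ⟨φ⟩ ⟨ψ⟩ ⟨χ⟩
    exact Quotient.sound (comp_assoc_equivalent χ)

end QGr

/-- The quotient functor `π : gr R ⥤ qgr R`. -/
noncomputable def qgrFunctor (𝒜 : ℤ → Submodule k R) : GrMod 𝒜 ⥤ QGr 𝒜 where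
  obj M := ⟨M⟩
  map f := ⟦ofHom f⟧
  map_id _ := rfl
  map_comp f g := Quotient.sound (equivalent_of ⊤ ⊥ (top_mem_cofinite _) (bot_mem_torsion _)
    fun m _ => ⟨_, _, ofHom_rel _ m, comp_rel (ofHom_rel f m) (ofHom_rel g _), by
      exact (Submodule.mem_bot _).2 (sub_self _)⟩)

end Graded

/-! Write `v a` for `op a • v`. In a finite-dimensional graded module every vector is killed by high
powers of `x` and `y`, since these move it through infinitely many degrees. As `x^n y^n` and `y^n
x^n` are explicit polynomials in `z`, such a vector is killed by their gcd. For `f = z(z + m)` and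
large `n` this forces `z` to act with all its roots in the window `0, -1, ..., -(m-1)`. Shifting the
window by `m` makes it disjoint from itself, so `x^m` and `y^m` act as zero
(`op_x_pow_smul_eq_zero`, `op_y_pow_smul_eq_zero`).

Hence, if homogeneous elements `p_t` generate `P`, every graded submodule of finite codimension
contains all `p_t x^m` and `p_t y^m`. These span a submodule of finite codimension, because `A/(x^m
A + y^m A)` is finite-dimensional (`finite_quotient_span_pow`). So this span is `κ(P)`, and it is
the image of a graded free module (`exists_freeLift_range_least`).

If `κ(P) = P`, the domain of any representative of a map out of `πP` is all of `P`. An epimorphism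
in `qgr A` hits a submodule of finite codimension (`image_mem_cofinite`), so the generators of `P`
lift, and a graded splitting of a free cover of `P` turns these lifts into a morphism of `gr A`.

Conversely, let `g : F → P` have image `κ(P)` with `F` graded free. Then `πg` is an epimorphism, and
if `πP` is projective it has a section, represented by a map to `F` from some `D ⊆ P` of finite
codimension. Maps from `D` to `A` extend to `P` (`exists_extension`, a depth-two property of `A`).
The extended map is a section of `g` on a submodule of finite codimension, hence everywhere, because
`P` has no `x`-torsion. So `g` is onto and `κ(P) = P`. -/

open GrMod QPreHom MulOpposite

/-! ### Commutation rules, Ore property and faithful `k[z]` in `A(f)`. -/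

namespace GWA

variable {k : Type u} [Field k] (f : k[X])

lemma gwaSigma_apply (p : k[X]) : gwaSigma k p = taylor 1 p := by
  rw [gwaSigma, algEquivAevalXAddC_apply, taylor_apply, aeval_eq_sum_range, comp_eq_sum_left,
    sum_over_range _ (by simp)]
  simp [smul_eq_C_mul]

lemma gwaSigma_symm_apply (p : k[X]) : (gwaSigma k).symm p = taylor (-1) p := by
  rw [AlgEquiv.symm_apply_eq, gwaSigma_apply, taylor_taylor]
  simp

lemma x_mul_z : gen f .x * gen f .z = (gen f .z + 1) * gen f .x := by
  have := rel f (GWARel.xz (f := f))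
  rw [map_mul, map_mul, mk_aeval, gwaSigma_apply] at this
  simpa [gen] using this

lemma y_mul_z : gen f .y * gen f .z = (gen f .z - 1) * gen f .y := by
  have := rel f (GWARel.yz (f := f))
  rw [map_mul, map_mul, mk_aeval, gwaSigma_symm_apply] at this
  simpa [gen, sub_eq_add_neg] using this

lemma x_mul_y : gen f .x * gen f .y = aeval (gen f .z) f := by
  have := rel f (GWARel.xy (f := f))
  rwa [map_mul, mk_aeval] at this

lemma y_mul_x : gen f .y * gen f .x = aeval (gen f .z) (taylor (-1) f) := by
  have := rel f (GWARel.yx (f := f))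
  rwa [map_mul, mk_aeval, gwaSigma_symm_apply] at this

lemma mul_aeval_of_mul_z {a : GWA f} {c : k}
    (h : a * gen f .z = (gen f .z + algebraMap k _ c) * a) (p : k[X]) :
    a * aeval (gen f .z) p = aeval (gen f .z) (taylor c p) * a := by
  induction p using Polynomial.induction_on with
  | C r => simpa using (Algebra.commutes r a).symm
  | add p q hp hq => simp only [map_add, mul_add, add_mul, hp, hq]
  | monomial n r ih =>
    rw [pow_succ, ← mul_assoc]
    generalize C r * X ^ n = q at ih ⊢
    rw [map_mul, aeval_X, ← mul_assoc, ih, mul_assoc, h, taylor_mul, map_mul, taylor_X, map_add,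
      aeval_X, aeval_C, mul_assoc]

lemma x_pow_mul_aeval (n : ℕ) (p : k[X]) :
    gen f .x ^ n * aeval (gen f .z) p = aeval (gen f .z) (taylor (n : k) p) * gen f .x ^ n := by
  induction n generalizing p with
  | zero => simp
  | succ n ih =>
    rw [pow_succ, mul_assoc, mul_aeval_of_mul_z f (c := 1) (by simpa using x_mul_z f),
      ← mul_assoc, ih, taylor_taylor, mul_assoc]
    push_cast
    rfl

lemma y_pow_mul_aeval (n : ℕ) (p : k[X]) :
    gen f .y ^ n * aeval (gen f .z) p = aeval (gen f .z) (taylor (-(n : k)) p) * gen f .y ^ n := by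
  induction n generalizing p with
  | zero => simp
  | succ n ih =>
    rw [pow_succ, mul_assoc, mul_aeval_of_mul_z f (c := -1)
      (by simpa [sub_eq_add_neg] using y_mul_z f), ← mul_assoc, ih, taylor_taylor, mul_assoc]
    push_cast
    rw [neg_add]

lemma aeval_mul_x_pow (n : ℕ) (p : k[X]) :
    aeval (gen f .z) p * gen f .x ^ n = gen f .x ^ n * aeval (gen f .z) (taylor (-(n : k)) p) := by
  rw [x_pow_mul_aeval, taylor_taylor]
  simp

lemma aeval_mul_y_pow (n : ℕ) (p : k[X]) :
    aeval (gen f .z) p * gen f .y ^ n = gen f .y ^ n * aeval (gen f .z) (taylor (n : k) p) := by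
  rw [y_pow_mul_aeval, taylor_taylor]
  simp

lemma x_pow_mul_y_pow (n : ℕ) : gen f .x ^ n * gen f .y ^ n =
    aeval (gen f .z) (∏ i ∈ Finset.range n, taylor (i : k) f) := by
  induction n with
  | zero => simp
  | succ n ih =>
    rw [pow_succ, pow_succ', mul_assoc, ← mul_assoc (gen f .x), x_mul_y, ← mul_assoc,
      x_pow_mul_aeval, mul_assoc, ih, ← map_mul, Finset.prod_range_succ, mul_comm]

lemma y_pow_mul_x_pow (n : ℕ) : gen f .y ^ n * gen f .x ^ n =
    aeval (gen f .z) (∏ i ∈ Finset.range n, taylor (-(i + 1 : k)) f) := by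
  induction n with
  | zero => simp
  | succ n ih =>
    rw [pow_succ, pow_succ', mul_assoc, ← mul_assoc (gen f .y), y_mul_x, ← mul_assoc,
      y_pow_mul_aeval, mul_assoc, ih, ← map_mul, Finset.prod_range_succ, mul_comm, taylor_taylor,
      neg_add]

/-- Induction over the generators of `A(f)`. -/
lemma gen_induction {p : GWA f → Prop} (a : GWA f) (scalar : ∀ c : k, p (algebraMap k _ c))
    (gen : ∀ g, p (gen f g)) (mul : ∀ a b, p a → p b → p (a * b))
    (add : ∀ a b, p a → p b → p (a + b)) : p a := by
  obtain ⟨w, rfl⟩ := RingQuot.mkAlgHom_surjective k (GWARel f) a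
  change p (mk f w)
  induction w using FreeAlgebra.induction with
  | grade0 c => rw [AlgHom.commutes]; exact scalar c
  | grade1 g => exact gen g
  | mul a b ha hb => rw [map_mul]; exact mul _ _ ha hb
  | add a b ha hb => rw [map_add]; exact add _ _ ha hb

/-- Powers of `t` can be moved to the left of a given element, once it is multiplied by a high
enough power of `t`. -/
def RightOre (t : GWA f) : Prop := ∀ (r : GWA f) (N : ℕ), ∃ n r', r * t ^ n = t ^ N * r'

variable {f} in
lemma rightOre_of_gen {t : GWA f} (h : ∀ g N, ∃ n r', gen f g * t ^ n = t ^ N * r') :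
    RightOre f t := by
  intro r
  refine gen_induction f (p := fun r => ∀ N, ∃ n r', r * t ^ n = t ^ N * r') r ?_ h ?_ ?_
  · exact fun c N => ⟨N, algebraMap k _ c, Algebra.commutes c _⟩
  · intro a b ha hb N
    obtain ⟨n, a', h₁⟩ := ha N
    obtain ⟨l, b', h₂⟩ := hb n
    exact ⟨l, a' * b', by rw [mul_assoc, h₂, ← mul_assoc, h₁, mul_assoc]⟩
  · intro a b ha hb N
    obtain ⟨n, a', h₁⟩ := ha N
    obtain ⟨l, b', h₂⟩ := hb N
    refine ⟨n + l, a' * t ^ l + b' * t ^ n, ?_⟩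
    rw [add_mul, mul_add, ← mul_assoc, ← h₁, ← mul_assoc, ← h₂, mul_assoc, mul_assoc, ← pow_add,
      ← pow_add, add_comm l]

lemma rightOre_x : RightOre f (gen f .x) := by
  refine rightOre_of_gen fun g N => ?_
  cases g with
  | z => exact ⟨N, _, by simpa using aeval_mul_x_pow f N X⟩
  | x => exact ⟨N, gen f .x, (Commute.refl _).pow_right N⟩
  -- One factor `x` is absorbed by `yx = σ⁻¹(f)`, hence the exponent `N + 1`; the polynomial then
  -- passes across `x^N`.
  | y => exact ⟨N + 1, _, by rw [pow_succ', ← mul_assoc, y_mul_x, aeval_mul_x_pow]⟩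

lemma rightOre_y : RightOre f (gen f .y) := by
  refine rightOre_of_gen fun g N => ?_
  cases g with
  | z => exact ⟨N, _, by simpa using aeval_mul_y_pow f N X⟩
  | x => exact ⟨N + 1, _, by rw [pow_succ', ← mul_assoc, x_mul_y, aeval_mul_y_pow]⟩
  | y => exact ⟨N, gen f .y, (Commute.refl _).pow_right N⟩

/-- The action of `A(f)` on `k[z]` in which `x` acts as `σ` and `y` as `σ⁻¹(f) σ⁻¹`. -/
noncomputable def polyRep : GWA f →ₐ[k] Module.End k k[X] :=
  RingQuot.liftAlgHom k ⟨FreeAlgebra.lift k fun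
    | .z => LinearMap.mulLeft k X
    | .x => taylor 1
    | .y => LinearMap.mulLeft k (taylor (-1) f) ∘ₗ taylor (-1), by
    have h : ∀ p q : k[X], aeval (LinearMap.mulLeft k (X : k[X])) p q = p * q := by
      intro p q
      have : LinearMap.mulLeft k (X : k[X]) = Algebra.lmul k k[X] X := rfl
      rw [this, aeval_algHom_apply]
      simp
    intro a b hab
    refine LinearMap.ext fun q => ?_
    cases hab <;>
      simp [gwaFree, ← aeval_algHom_apply, h, gwaSigma_apply, gwaSigma_symm_apply, taylor_mul,
        taylor_taylor, add_mul, mul_add, mul_left_comm]⟩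

lemma polyRep_aeval (p : k[X]) : polyRep f (aeval (gen f .z) p) 1 = p := by
  have h : polyRep f (gen f .z) = Algebra.lmul k k[X] X := by
    refine (RingQuot.liftAlgHom_mkAlgHom_apply ..).trans ?_
    rw [gwaFree, FreeAlgebra.lift_ι_apply]
    rfl
  rw [← aeval_algHom_apply, h, aeval_algHom_apply]
  simp

/-- The presentation could a priori collapse `k[z]`; the action on `k[z]` recovers `p` as the value
of `p(z)` at `1`. -/
lemma aeval_z_injective : Function.Injective (aeval (gen f .z) : k[X] →ₐ[k] GWA f) :=
  Function.LeftInverse.injective (g := fun a => polyRep f a 1) (polyRep_aeval f)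

/-! ### Homogeneous components of `A(f)` and right cancellation of `x` and `y`. -/

/-- The monomial of degree `n` in `x` or `y`. -/
noncomputable def monom (n : ℤ) : GWA f := gen f .x ^ n.toNat * gen f .y ^ (-n).toNat

lemma monom_natCast (n : ℕ) : monom f n = gen f .x ^ n := by
  simp [monom]

lemma monom_neg_natCast (n : ℕ) : monom f (-n) = gen f .y ^ n := by
  simp [monom]

/-- Induction on words: a new letter on the left twists the polynomial by a shift, then either
lengthens the monomial or cancels against its first letter through `xy = f` or `yx = σ⁻¹(f)`. -/
lemma exists_aeval_mul_monom {n : ℤ} {a : GWA f} (ha : a ∈ component f n) :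
    ∃ p : k[X], a = aeval (gen f .z) p * monom f n := by
  induction ha using Submodule.span_induction with
  | zero => exact ⟨0, by simp⟩
  | add a b _ _ ha hb =>
    obtain ⟨p, rfl⟩ := ha
    obtain ⟨q, rfl⟩ := hb
    exact ⟨p + q, by rw [map_add, add_mul]⟩
  | smul c a _ ha =>
    obtain ⟨p, rfl⟩ := ha
    exact ⟨c • p, by rw [map_smul, smul_mul_assoc]⟩
  | mem a h =>
    obtain ⟨w, rfl, rfl⟩ := h
    induction w with
    | nil => exact ⟨1, by simp [monom]⟩
    | cons g w ih =>
      obtain ⟨p, hp⟩ := ih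
      rw [List.map_cons, List.prod_cons, hp, List.map_cons, List.sum_cons]
      generalize (w.map GWAGen.deg).sum = n
      cases g with
      | z => exact ⟨X * p, by simp [GWAGen.deg, mul_assoc]⟩
      | x =>
        have h := x_pow_mul_aeval f 1 p
        simp only [pow_one, Nat.cast_one] at h
        rw [← mul_assoc, h, mul_assoc]
        rcases n.eq_nat_or_neg with ⟨n, rfl | rfl⟩
        · refine ⟨taylor 1 p, ?_⟩
          have : GWAGen.deg .x + (n : ℤ) = ((n + 1 : ℕ) : ℤ) := by simp [GWAGen.deg, add_comm]
          rw [this, monom_natCast, monom_natCast, pow_succ']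
        · cases n with
          | zero =>
            refine ⟨taylor 1 p, ?_⟩
            simp [monom, GWAGen.deg]
          | succ n =>
            refine ⟨taylor 1 p * f, ?_⟩
            have : GWAGen.deg .x + -((n + 1 : ℕ) : ℤ) = -(n : ℤ) := by simp [GWAGen.deg]
            rw [this, monom_neg_natCast, monom_neg_natCast, pow_succ', ← mul_assoc (gen f .x),
              x_mul_y, map_mul, mul_assoc]
      | y =>
        have h := y_pow_mul_aeval f 1 p
        simp only [pow_one, Nat.cast_one] at h
        rw [← mul_assoc, h, mul_assoc]
        rcases n.eq_nat_or_neg with ⟨n, rfl | rfl⟩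
        · cases n with
          | zero =>
            refine ⟨taylor (-1) p, ?_⟩
            simp [monom, GWAGen.deg]
          | succ n =>
            refine ⟨taylor (-1) p * taylor (-1) f, ?_⟩
            have : GWAGen.deg .y + ((n + 1 : ℕ) : ℤ) = (n : ℤ) := by simp [GWAGen.deg]
            rw [this, monom_natCast, monom_natCast, pow_succ', ← mul_assoc (gen f .y),
              y_mul_x, map_mul, mul_assoc]
        · refine ⟨taylor (-1) p, ?_⟩
          have : GWAGen.deg .y + -(n : ℤ) = -((n + 1 : ℕ) : ℤ) := by
            simp [GWAGen.deg]
          rw [this, monom_neg_natCast, monom_neg_natCast, pow_succ']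

lemma exists_aeval_mul_x_pow {n : ℕ} {a : GWA f} (ha : a ∈ component f n) :
    ∃ p : k[X], a = aeval (gen f .z) p * gen f .x ^ n := by
  simpa only [monom_natCast] using exists_aeval_mul_monom f ha

lemma exists_aeval_mul_y_pow {n : ℕ} {a : GWA f} (ha : a ∈ component f (-n)) :
    ∃ p : k[X], a = aeval (gen f .z) p * gen f .y ^ n := by
  simpa only [monom_neg_natCast] using exists_aeval_mul_monom f ha

/-- Since `b` is homogeneous, the components of `a * b` are the products of those of `a` with `b`.
-/
lemma eq_zero_of_mul_eq_zero_of_homogeneous {b : GWA f} {d : ℤ} (hb : b ∈ component f d)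
    (h : ∀ n, ∀ a ∈ component f n, a * b = 0 → a = 0) (a : GWA f) (hab : a * b = 0) : a = 0 := by
  have h' : ∀ i, (DirectSum.decompose (component f) a i : GWA f) = 0 := fun i => by
    refine h i _ (SetLike.coe_mem _) ?_
    rw [← DirectSum.coe_decompose_mul_add_of_right_mem (component f) hb, hab]
    simp
  apply (DirectSum.decompose (component f)).injective
  rw [DirectSum.decompose_zero]
  exact DFinsupp.ext fun i => Subtype.ext (h' i)

variable {f}

lemma aeval_eq_zero_of_mul_x_pow_mul_y_pow (hf : f ≠ 0) {p : k[X]} {n : ℕ}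
    (h : aeval (gen f .z) p * (gen f .x ^ n * gen f .y ^ n) = 0) : p = 0 := by
  rw [x_pow_mul_y_pow, ← map_mul] at h
  have := aeval_z_injective f (h.trans (map_zero _).symm)
  refine (mul_eq_zero.1 this).resolve_right (Finset.prod_ne_zero_iff.2 fun i _ => ?_)
  rwa [Ne, taylor_eq_zero]

lemma aeval_eq_zero_of_mul_y_pow_mul_x_pow (hf : f ≠ 0) {p : k[X]} {n : ℕ}
    (h : aeval (gen f .z) p * (gen f .y ^ n * gen f .x ^ n) = 0) : p = 0 := by
  rw [y_pow_mul_x_pow, ← map_mul] at h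
  have := aeval_z_injective f (h.trans (map_zero _).symm)
  refine (mul_eq_zero.1 this).resolve_right (Finset.prod_ne_zero_iff.2 fun i _ => ?_)
  rwa [Ne, taylor_eq_zero]

/-- A homogeneous `a` is `p(z)` times a power of `x` or `y`. Further right multiplication turns `a x
= 0` into `p` times a product of shifts of `f` being zero in the domain `k[z]`. -/
lemma eq_zero_of_mul_x_eq_zero (hf : f ≠ 0) (a : GWA f) (ha : a * gen f .x = 0) : a = 0 := by
  refine eq_zero_of_mul_eq_zero_of_homogeneous f (gen_mem f .x) (fun n a ha h => ?_) a ha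
  have key : ∀ n : ℕ, ∀ p : k[X], aeval (gen f .z) p * gen f .x ^ n * gen f .x = 0 → p = 0 := by
    intro n p h
    refine aeval_eq_zero_of_mul_x_pow_mul_y_pow hf (n := n + 1) ?_
    rw [← mul_assoc, pow_succ, ← mul_assoc (aeval _ p), h, zero_mul]
  rcases n.eq_nat_or_neg with ⟨n, rfl | rfl⟩
  · obtain ⟨p, rfl⟩ := exists_aeval_mul_x_pow f ha
    rw [key n p h, map_zero, zero_mul]
  · obtain ⟨p, rfl⟩ := exists_aeval_mul_y_pow f ha
    cases n with
    | zero => rw [key 0 p (by simpa using h), map_zero, zero_mul]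
    | succ n =>
      rw [aeval_eq_zero_of_mul_y_pow_mul_x_pow hf (p := p) (n := n + 1), map_zero, zero_mul]
      rw [pow_succ' (gen f .x), ← mul_assoc, ← mul_assoc, h, zero_mul]

lemma eq_zero_of_mul_y_eq_zero (hf : f ≠ 0) (a : GWA f) (ha : a * gen f .y = 0) : a = 0 := by
  refine eq_zero_of_mul_eq_zero_of_homogeneous f (gen_mem f .y) (fun n a ha h => ?_) a ha
  have key : ∀ n : ℕ, ∀ p : k[X], aeval (gen f .z) p * gen f .y ^ n * gen f .y = 0 → p = 0 := by
    intro n p h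
    refine aeval_eq_zero_of_mul_y_pow_mul_x_pow hf (n := n + 1) ?_
    rw [← mul_assoc, pow_succ, ← mul_assoc (aeval _ p), h, zero_mul]
  rcases n.eq_nat_or_neg with ⟨n, rfl | rfl⟩
  · obtain ⟨p, rfl⟩ := exists_aeval_mul_x_pow f ha
    cases n with
    | zero => rw [key 0 p (by simpa using h), map_zero, zero_mul]
    | succ n =>
      rw [aeval_eq_zero_of_mul_x_pow_mul_y_pow hf (p := p) (n := n + 1), map_zero, zero_mul]
      rw [pow_succ' (gen f .y), ← mul_assoc, ← mul_assoc, h, zero_mul]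
  · obtain ⟨p, rfl⟩ := exists_aeval_mul_y_pow f ha
    rw [key n p h, map_zero, zero_mul]

lemma eq_zero_of_mul_pow_eq_zero {t : GWA f} (ht : ∀ a, a * t = 0 → a = 0) (n : ℕ) (a : GWA f)
    (ha : a * t ^ n = 0) : a = 0 := by
  induction n with
  | zero => simpa using ha
  | succ n ih =>
    rw [pow_succ, ← mul_assoc] at ha
    exact ih (ht _ ha)

end GWA

/-! ### Nilpotence of `x` and `y` for `f = z(z + m)`. -/

namespace GWA

variable {k : Type u} [Field k]

section Nilpotent

variable {f : k[X]} {V : Type u} [AddCommGroup V] [Module (GWA f)ᵐᵒᵖ V]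

lemma op_mul_smul (a b : GWA f) (v : V) : op (a * b) • v = op b • op a • v := by
  rw [op_mul, mul_smul]

lemma op_pow_smul_eq_zero_of_le {t : GWA f} {v : V} {m n : ℕ} (h : m ≤ n)
    (hv : op (t ^ m) • v = 0) : op (t ^ n) • v = 0 := by
  obtain ⟨l, rfl⟩ := Nat.exists_eq_add_of_le h
  rw [pow_add, op_mul_smul, hv, smul_zero]

lemma op_aeval_smul_eq_zero_of_isCoprime {v : V} {p q r : k[X]} (h : IsCoprime p q)
    (hp : op (aeval (gen f .z) (r * p)) • v = 0) (hq : op (aeval (gen f .z) (r * q)) • v = 0) :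
    op (aeval (gen f .z) r) • v = 0 := by
  obtain ⟨a, b, hab⟩ := h
  have : r = r * p * a + r * q * b := by linear_combination -r * hab
  rw [this, map_add, MulOpposite.op_add, add_smul, map_mul _ (r * p), map_mul _ (r * q), op_mul_smul,
    op_mul_smul, hp, hq, smul_zero, smul_zero, add_zero]

/-- The product of the `z + i` for `i < n`, shifted by `c`. -/
noncomputable def rising (c : k) (n : ℕ) : k[X] := ∏ i ∈ Finset.range n, (X + C (c + i))

lemma taylor_rising (a c : k) (n : ℕ) : taylor a (rising c n) = rising (a + c) n := by
  simp only [rising, ← taylorAlgHom_apply, map_prod]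
  refine Finset.prod_congr rfl fun i _ => ?_
  simp only [taylorAlgHom_apply, map_add, taylor_X, taylor_C]
  ring_nf

lemma isCoprime_rising {c d : k} {n l : ℕ}
    (h : ∀ i < n, ∀ j < l, c + (i : k) ≠ d + j) : IsCoprime (rising c n) (rising d l) := by
  refine IsCoprime.prod_left fun i hi => IsCoprime.prod_right fun j hj => ?_
  have := h i (Finset.mem_range.1 hi) j (Finset.mem_range.1 hj)
  have h := isCoprime_X_sub_C_of_isUnit_sub (a := -(c + i : k)) (b := -(d + j : k))
    (IsUnit.mk0 _ (by rw [neg_sub_neg]; exact sub_ne_zero.2 this.symm))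
  simpa only [C_neg, sub_neg_eq_add] using h

lemma rising_add (c : k) (n l : ℕ) : rising c (n + l) = rising c n * rising (c + n) l := by
  rw [rising, Finset.prod_range_add]
  congr 1
  refine Finset.prod_congr rfl fun i _ => ?_
  push_cast
  ring_nf

end Nilpotent

variable (k) in
/-- The polynomial `z(z + m)`. -/
noncomputable abbrev poly (m : ℕ) : k[X] := X * (X + C (m : k))

lemma poly_ne_zero (m : ℕ) : poly k m ≠ 0 := mul_ne_zero X_ne_zero (X_add_C_ne_zero _)

lemma prod_taylor_poly (m n : ℕ) : ∏ i ∈ Finset.range n, taylor (i : k) (poly k m) =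
    rising (0 : k) n * rising (m : k) n := by
  simp only [taylor_mul, Finset.prod_mul_distrib, rising, map_add, taylor_X, taylor_C]
  congr 1 <;> refine Finset.prod_congr rfl fun i _ => ?_
  · rw [C_0, zero_add]
  · ring

lemma prod_taylor_neg_poly (m n : ℕ) :
    ∏ i ∈ Finset.range n, taylor (-(i + 1 : k)) (poly k m) =
    rising (-n : k) n * rising (m - n : k) n := by
  simp only [taylor_mul, Finset.prod_mul_distrib, rising, map_add, taylor_X, taylor_C]
  -- The shifts `-1, ..., -n` occur in descending order; reflecting the index makes them ascend from
  -- `-n`, as in `rising`.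
  congr 1 <;> rw [← Finset.prod_range_reflect] <;> refine Finset.prod_congr rfl fun i hi => ?_
  all_goals
    have h : ((n - 1 - i : ℕ) : k) = n - 1 - i := by
      have := Finset.mem_range.1 hi
      rw [Nat.cast_sub (by omega), Nat.cast_sub (by omega), Nat.cast_one]
    rw [h]
    simp only [C_neg, C_add, C_sub, C_1]
    ring

variable [CharZero k] {m : ℕ} {V : Type u} [AddCommGroup V] [Module (GWA (poly k m))ᵐᵒᵖ V]

/-- The vector is killed by `x^N y^N` and `y^N x^N`. Both polynomials contain `rising 0 m`; the
cofactor of the first has roots at most `-m`, that of the second has positive integer roots, so the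
cofactors are coprime. -/
lemma op_rising_smul_eq_zero {v : V} {n₁ n₂ : ℕ} (hx : op (gen (poly k m) .x ^ n₁) • v = 0)
    (hy : op (gen (poly k m) .y ^ n₂) • v = 0) :
    op (aeval (gen (poly k m) .z) (rising (0 : k) m)) • v = 0 := by
  -- The common exponent `m + M` dominates `n₁` and `n₂`, and is at least `m`, so that `rising 0 m`
  -- splits off both products.
  let M := n₁ + n₂
  have hx' := op_pow_smul_eq_zero_of_le (show n₁ ≤ m + M by omega) hx
  have hy' := op_pow_smul_eq_zero_of_le (show n₂ ≤ m + M by omega) hy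
  have h₁ := op_mul_smul (gen (poly k m) .x ^ (m + M)) (gen (poly k m) .y ^ (m + M)) v
  have h₂ := op_mul_smul (gen (poly k m) .y ^ (m + M)) (gen (poly k m) .x ^ (m + M)) v
  rw [hx', smul_zero, x_pow_mul_y_pow, prod_taylor_poly, rising_add, mul_assoc] at h₁
  rw [hy', smul_zero, y_pow_mul_x_pow, prod_taylor_neg_poly, add_comm m M, mul_comm,
    add_comm M m] at h₂
  have e₂ : rising ((m : k) - ((m + M : ℕ) : k)) (m + M) =
      rising (0 : k) m * rising (-(M : k)) M := by
    rw [add_comm m M, rising_add, mul_comm]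
    congr 2 <;> push_cast <;> ring_nf
  rw [e₂, mul_assoc] at h₂
  refine op_aeval_smul_eq_zero_of_isCoprime ?_ h₁ h₂
  have key : ∀ a b : ℕ, ∀ l, (l : ℕ) < b → ∀ c : k, c = a → c ≠ -(b : k) + l := by
    intro a b l hl c hc h
    have : ((a + b : ℕ) : k) = (l : ℕ) := by push_cast; linear_combination -hc + h
    have := Nat.cast_injective this
    omega
  refine IsCoprime.mul_left (IsCoprime.mul_right ?_ ?_) (IsCoprime.mul_right ?_ ?_) <;>
    refine isCoprime_rising fun i hi j hj => ?_
  · exact key (m + i) M j hj _ (by push_cast; ring)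
  · exact key (m + i) (m + M) j hj _ (by push_cast; ring)
  · exact key (m + i) M j hj _ (by push_cast; ring)
  · exact key (m + i) (m + M) j hj _ (by push_cast; ring)

/-- By the previous lemma `v x^m` is killed by `rising 0 m`. Moving `x^m` across the same relation
for `v` shows that it is also killed by `rising (-m) m`, whose roots `1, ..., m` are disjoint from
`0, ..., -(m-1)`. -/
lemma op_x_pow_smul_eq_zero (hx : ∀ v : V, ∃ n, op (gen (poly k m) .x ^ n) • v = 0)
    (hy : ∀ v : V, ∃ n, op (gen (poly k m) .y ^ n) • v = 0) (v : V) :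
    op (gen (poly k m) .x ^ m) • v = 0 := by
  have h : ∀ v : V, op (aeval (gen (poly k m) .z) (rising (0 : k) m)) • v = 0 := fun v =>
    op_rising_smul_eq_zero (hx v).choose_spec (hy v).choose_spec
  have h₁ := h (op (gen (poly k m) .x ^ m) • v)
  have h₂ := op_mul_smul (aeval (gen (poly k m) .z) (rising (0 : k) m)) (gen (poly k m) .x ^ m) v
  rw [h, smul_zero, aeval_mul_x_pow, op_mul_smul, taylor_rising] at h₂
  have hc : IsCoprime (rising (0 : k) m) (rising (-(m : k) + 0) m) := by
    refine isCoprime_rising fun i hi j hj h => ?_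
    have : ((m + i : ℕ) : k) = (j : ℕ) := by push_cast; linear_combination h
    have := Nat.cast_injective this
    omega
  have := op_aeval_smul_eq_zero_of_isCoprime (r := 1) hc (by rwa [one_mul]) (by rwa [one_mul])
  simpa using this

lemma op_y_pow_smul_eq_zero (hx : ∀ v : V, ∃ n, op (gen (poly k m) .x ^ n) • v = 0)
    (hy : ∀ v : V, ∃ n, op (gen (poly k m) .y ^ n) • v = 0) (v : V) :
    op (gen (poly k m) .y ^ m) • v = 0 := by
  have h : ∀ v : V, op (aeval (gen (poly k m) .z) (rising (0 : k) m)) • v = 0 := fun v =>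
    op_rising_smul_eq_zero (hx v).choose_spec (hy v).choose_spec
  have h₁ := h (op (gen (poly k m) .y ^ m) • v)
  have h₂ := op_mul_smul (aeval (gen (poly k m) .z) (rising (0 : k) m)) (gen (poly k m) .y ^ m) v
  rw [h, smul_zero, aeval_mul_y_pow, op_mul_smul, taylor_rising] at h₂
  have hc : IsCoprime (rising (0 : k) m) (rising ((m : k) + 0) m) := by
    refine isCoprime_rising fun i hi j hj h => ?_
    have : ((i : ℕ) : k) = ((m + j : ℕ) : k) := by push_cast; linear_combination h
    have := Nat.cast_injective this
    omega
  have := op_aeval_smul_eq_zero_of_isCoprime (r := 1) hc (by rwa [one_mul]) (by rwa [one_mul])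
  simpa using this

end GWA

/-! ### Finite-dimensionality of `A/(x^n A + y^n A)`. -/

namespace GWA

variable {k : Type u} [Field k]

lemma finite_quotient_span_pow {f : k[X]} (hf : f ≠ 0) (n : ℕ) :
    Module.Finite k (GWA f ⧸ (Submodule.span (GWA f)ᵐᵒᵖ {gen f .x ^ n, gen f .y ^ n})) := by
  set J := Submodule.span (GWA f)ᵐᵒᵖ {gen f .x ^ n, gen f .y ^ n} with hJ
  have hx : ∀ r, gen f .x ^ n * r ∈ J := fun r =>
    J.smul_mem (op r) (Submodule.subset_span (by simp))
  have hy : ∀ r, gen f .y ^ n * r ∈ J := fun r =>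
    J.smul_mem (op r) (Submodule.subset_span (by simp))
  set H : k[X] := ∏ i ∈ Finset.range n, taylor (i : k) f with hH
  have hH0 : H ≠ 0 := Finset.prod_ne_zero_iff.2 fun i _ => by rwa [Ne, taylor_eq_zero]
  -- `W` collects representatives modulo `J`: degrees `j` with `|j| ≥ n` lie in `J`, and in the
  -- other degrees the polynomial coefficient matters only modulo `H`, because `H(z) = x^n y^n`.
  let W : Submodule k (GWA f) := ⨆ j ∈ Finset.Ioo (-n : ℤ) n, (degreeLT k H.natDegree).map
    (LinearMap.mulRight k (monom f j) ∘ₗ (aeval (gen f .z) : k[X] →ₐ[k] GWA f).toLinearMap)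
  have hW : W.FG := Submodule.fg_biSup _ _ fun j _ =>
    (Module.Finite.iff_fg.1 (Module.Finite.equiv (degreeLTEquiv k H.natDegree).symm)).map _
  have hWJ : ∀ a : GWA f, a ∈ W ⊔ J.restrictScalars k := by
    intro a
    induction a using DirectSum.Decomposition.inductionOn (component f) with
    | zero => exact zero_mem _
    | add a b ha hb => exact add_mem ha hb
    | @homogeneous i a =>
      by_cases hi : i ∈ Finset.Ioo (-n : ℤ) n
      · obtain ⟨p, hp⟩ := exists_aeval_mul_monom f a.2
        rw [hp, ← EuclideanDomain.div_add_mod p H, add_comm, map_add, add_mul]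
        refine Submodule.add_mem_sup ?_ ?_
        · refine Submodule.mem_iSup_of_mem i (Submodule.mem_iSup_of_mem hi ⟨p % H, ?_, rfl⟩)
          refine mem_degreeLT.2 ?_
          rw [← degree_eq_natDegree hH0]
          exact EuclideanDomain.mod_lt p hH0
        · rw [map_mul, hH, ← x_pow_mul_y_pow, mul_assoc, mul_assoc]
          exact hx _
      · refine Submodule.mem_sup_right ?_
        change (a : GWA f) ∈ J
        rcases i.eq_nat_or_neg with ⟨l, rfl | rfl⟩
        · obtain ⟨p, hp⟩ := exists_aeval_mul_x_pow f a.2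
          have : n ≤ l := by simp only [Finset.mem_Ioo] at hi; omega
          obtain ⟨c, rfl⟩ := Nat.exists_eq_add_of_le this
          rw [hp, pow_add, ← mul_assoc, aeval_mul_x_pow, mul_assoc]
          exact hx _
        · obtain ⟨p, hp⟩ := exists_aeval_mul_y_pow f a.2
          have : n ≤ l := by simp only [Finset.mem_Ioo] at hi; omega
          obtain ⟨c, rfl⟩ := Nat.exists_eq_add_of_le this
          rw [hp, pow_add, ← mul_assoc, aeval_mul_y_pow, mul_assoc]
          exact hy _
  have : Module.Finite k W := Module.Finite.iff_fg.2 hW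
  refine Module.Finite.of_surjective ((J.mkQ.restrictScalars k) ∘ₗ W.subtype) fun q => ?_
  obtain ⟨a, rfl⟩ := J.mkQ_surjective q
  obtain ⟨w, hw, j, hj, rfl⟩ := Submodule.mem_sup.1 (hWJ a)
  refine ⟨⟨w, hw⟩, ?_⟩
  change J.mkQ w = J.mkQ (w + j)
  rw [map_add, show J.mkQ j = 0 from (Submodule.Quotient.mk_eq_zero J).2 hj, add_zero]

end GWA

/-! ### Quotients, free modules and projectives in `gr R`. -/

namespace GrMod

variable {k : Type u} [Field k] {R : Type u} [Ring R] [Algebra k R]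
variable {𝒜 : ℤ → Submodule k R}

lemma isInternal_of_sum {V : Type u} [AddCommGroup V] [Module k V] (ℳ : ℤ → Submodule k V)
    (h : ∀ (s : Finset ℤ) (v : ℤ → V), (∀ i ∈ s, v i ∈ ℳ i) → ∑ i ∈ s, v i = 0 → ∀ i ∈ s, v i = 0)
    (htop : ∀ v, v ∈ ⨆ i, ℳ i) : DirectSum.IsInternal ℳ := by
  rw [DirectSum.isInternal_submodule_iff_iSupIndep_and_iSup_eq_top]
  exact ⟨(iSupIndep_iff_finsetSum_eq_zero_imp_eq_zero ℳ).2 h, eq_top_iff.2 fun v _ => htop v⟩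

lemma decompose_sum_apply (M : GrMod 𝒜) {s : Finset ℤ} {v : ℤ → M}
    (hv : ∀ i ∈ s, v i ∈ M.component i) {j : ℤ} (hj : j ∈ s) :
    (DirectSum.decompose M.component (∑ i ∈ s, v i) j : M) = v j := by
  rw [DirectSum.decompose_sum, DFinsupp.finsetSum_apply, AddSubmonoidClass.coe_finsetSum,
    Finset.sum_eq_single_of_mem j hj]
  · exact DirectSum.decompose_of_mem_same _ (hv j hj)
  · exact fun i hi hij => DirectSum.decompose_of_mem_ne _ (hv i hi) hij

/-- The quotient of a graded module by a graded submodule. -/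
noncomputable def quot (M : GrMod 𝒜) (D : Submodule Rᵐᵒᵖ M) (hD : D.IsHomogeneous M.component) :
    GrMod 𝒜 :=
  let comp : ℤ → Submodule k (M ⧸ D) := fun i => (M.component i).map (D.mkQ.restrictScalars k)
  have hint : DirectSum.IsInternal comp := by
    refine isInternal_of_sum _ (fun s v hv h0 j hj => ?_) fun v => ?_
    · choose! w hw hwv using hv
      have h1 : ∑ i ∈ s, w i ∈ D := by
        rw [← Submodule.Quotient.mk_eq_zero]
        change D.mkQ _ = 0
        rw [map_sum, ← h0]
        exact Finset.sum_congr rfl fun i hi => hwv i hi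
      have := hD j h1
      rw [decompose_sum_apply M hw hj] at this
      rw [← hwv j hj]
      exact (Submodule.Quotient.mk_eq_zero D).2 this
    · obtain ⟨m, rfl⟩ := D.mkQ_surjective v
      classical
      rw [← DirectSum.sum_support_decompose M.component m, map_sum]
      exact Submodule.sum_mem _ fun i _ => Submodule.mem_iSup_of_mem i
        ⟨_, SetLike.coe_mem _, rfl⟩
  { carrier := M ⧸ D
    component := comp
    decomposition := hint.chooseDecomposition
    smul_mem := by
      rintro i j _ a ⟨m, hm, rfl⟩ ha
      exact ⟨op a • m, M.smul_mem hm ha, map_smul D.mkQ _ _⟩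
    finite := by
      have := M.finite
      infer_instance }

/-- The projection onto a quotient. -/
noncomputable def quotHom (M : GrMod 𝒜) (D : Submodule Rᵐᵒᵖ M)
    (hD : D.IsHomogeneous M.component) : M ⟶ M.quot D hD where
  toLinearMap := D.mkQ
  map_mem _ m hm := ⟨m, hm, rfl⟩

/-- The zero morphism. -/
def zeroHom (M N : GrMod 𝒜) : M ⟶ N where
  toLinearMap := 0
  map_mem _ _ _ := zero_mem _

lemma Hom.map_decompose {M N : GrMod 𝒜} (f : M ⟶ N) (m : M) (i : ℤ) :
    f.toLinearMap (DirectSum.decompose M.component m i) =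
      DirectSum.decompose N.component (f.toLinearMap m) i := by
  have := (ofHom_rel f m).proj i
  exact (rel_ofHom this).symm

lemma Hom.range_isHomogeneous {M N : GrMod 𝒜} (f : M ⟶ N) :
    (LinearMap.range f.toLinearMap).IsHomogeneous N.component := by
  rintro i _ ⟨m, rfl⟩
  exact ⟨_, Hom.map_decompose f m i⟩

section Free

variable [GradedAlgebra 𝒜] (𝒜)
variable (ι : Type u) [Fintype ι] (d : ι → ℤ)

/-- The graded free module with generators of degrees `d t`. -/
noncomputable def free : GrMod 𝒜 :=
  let comp : ℤ → Submodule k (ι → R) := fun n => Submodule.pi Set.univ fun t => 𝒜 (n - d t)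
  have hint : DirectSum.IsInternal comp := by
    classical
    refine isInternal_of_sum _ (fun s v hv h0 j hj => funext fun t => ?_) fun v => ?_
    · have h := (iSupIndep_iff_finsetSum_eq_zero_imp_eq_zero 𝒜).1
        (DirectSum.Decomposition.isInternal 𝒜).submodule_iSupIndep
        (s.map (Equiv.subRight (d t)).toEmbedding) (fun i => v (i + d t) t)
      simp only [Finset.sum_map, Finset.mem_map] at h
      simpa using h (by
        rintro _ ⟨i, hi, rfl⟩
        simpa using hv i hi t trivial) (by simpa using congrFun h0 t) _ ⟨j, hj, rfl⟩
    · rw [← Finset.univ_sum_single v]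
      refine Submodule.sum_mem _ fun t _ => ?_
      rw [← DirectSum.sum_support_decompose 𝒜 (v t)]
      rw [← LinearMap.coe_single k, map_sum]
      refine Submodule.sum_mem _ fun i _ => Submodule.mem_iSup_of_mem (i + d t) fun t' _ => ?_
      rw [LinearMap.coe_single]
      by_cases h : t' = t
      · subst h
        simp
      · simp [h]
  { carrier := ι → R
    component := comp
    decomposition := hint.chooseDecomposition
    smul_mem := by
      intro i j v a hv ha t _
      have := SetLike.mul_mem_graded (hv t trivial) ha
      rwa [show i - d t + j = i + j - d t by ring] at this
    finite := by
      have : Module.Finite Rᵐᵒᵖ R := ⟨⟨{1}, eq_top_iff.2 fun r _ => by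
        have := (Submodule.span Rᵐᵒᵖ {(1 : R)}).smul_mem (op r) (Submodule.mem_span_singleton_self 1)
        simpa using this⟩⟩
      infer_instance }

variable {ι d 𝒜}

/-- The morphism from a graded free module given by the images of the generators. -/
noncomputable def freeLift {M : GrMod 𝒜} (p : ι → M) (hp : ∀ t, p t ∈ M.component (d t)) :
    free 𝒜 ι d ⟶ M where
  toLinearMap :=
    { toFun := fun v : ι → R => ∑ t, op (v t) • p t
      map_add' := fun v w => by
        rw [← Finset.sum_add_distrib]
        exact Finset.sum_congr rfl fun t _ => by rw [← add_smul]; rfl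
      map_smul' := fun r v => by
        rw [Finset.smul_sum]
        refine Finset.sum_congr rfl fun t _ => ?_
        rw [RingHom.id_apply, smul_smul]
        rfl }
  map_mem i v hv := by
    refine Submodule.sum_mem _ fun t _ => ?_
    have := M.smul_mem (hp t) (hv t trivial)
    rwa [add_sub_cancel] at this

lemma freeLift_apply {M : GrMod 𝒜} (p : ι → M) (hp : ∀ t, p t ∈ M.component (d t)) (v : ι → R) :
    (freeLift p hp).toLinearMap v = ∑ t, op (v t) • p t := rfl

lemma range_freeLift {M : GrMod 𝒜} (p : ι → M) (hp : ∀ t, p t ∈ M.component (d t)) :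
    LinearMap.range (freeLift p hp).toLinearMap = Submodule.span Rᵐᵒᵖ (Set.range p) := by
  apply le_antisymm
  · rintro _ ⟨v, rfl⟩
    exact Submodule.sum_mem _ fun t _ =>
      Submodule.smul_mem _ _ (Submodule.subset_span ⟨t, rfl⟩)
  · refine Submodule.span_le.2 ?_
    rintro _ ⟨t, rfl⟩
    classical
    refine ⟨(Pi.single t 1 : ι → R), ?_⟩
    rw [freeLift_apply, Finset.sum_eq_single t]
    · simp
    · intro t' _ h
      simp [h]
    · simp

end Free

lemma exists_homogeneous_generators (M : GrMod 𝒜) : ∃ (ι : Type u) (_ : Fintype ι) (d : ι → ℤ)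
    (p : ι → M), (∀ t, p t ∈ M.component (d t)) ∧ Submodule.span Rᵐᵒᵖ (Set.range p) = ⊤ := by
  classical
  obtain ⟨s, hs⟩ := M.finite
  let S : Finset M := s.biUnion fun m => (DirectSum.decompose M.component m).support.image
    fun i => (DirectSum.decompose M.component m i : M)
  have hS : ∀ p : S, ∃ i, (p : M) ∈ M.component i := by
    rintro ⟨p, hp⟩
    obtain ⟨m, -, hp⟩ := Finset.mem_biUnion.1 hp
    obtain ⟨i, -, rfl⟩ := Finset.mem_image.1 hp
    exact ⟨i, SetLike.coe_mem _⟩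
  choose d hd using hS
  refine ⟨S, inferInstance, d, Subtype.val, hd, ?_⟩
  rw [eq_top_iff, ← hs, Submodule.span_le]
  intro m hm
  rw [SetLike.mem_coe, ← DirectSum.sum_support_decompose M.component m]
  refine Submodule.sum_mem _ fun i hi => Submodule.subset_span ⟨⟨_, ?_⟩, rfl⟩
  exact Finset.mem_biUnion.2 ⟨m, hm, Finset.mem_image.2 ⟨i, hi, rfl⟩⟩

lemma epi_of_surjective {M N : GrMod 𝒜} (f : M ⟶ N) (hf : Function.Surjective f.toLinearMap) :
    Epi f := by
  refine ⟨fun g h hgh => Hom.ext (LinearMap.ext fun n => ?_)⟩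
  obtain ⟨m, rfl⟩ := hf n
  exact LinearMap.congr_fun (congrArg Hom.toLinearMap hgh) m

/-- A projective graded module is a direct summand of a graded free module. -/
lemma exists_retract_free [GradedAlgebra 𝒜] (P : GrMod 𝒜) [Projective P] :
    ∃ (ι : Type u) (_ : Fintype ι) (d : ι → ℤ) (p : ι → P) (hp : ∀ t, p t ∈ P.component (d t))
      (i : P ⟶ free 𝒜 ι d), Submodule.span Rᵐᵒᵖ (Set.range p) = ⊤ ∧ i ≫ freeLift p hp = 𝟙 P := by
  obtain ⟨ι, _, d, p, hp, hs⟩ := P.exists_homogeneous_generators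
  have : Epi (freeLift p hp) := epi_of_surjective _ (by
    rw [← LinearMap.range_eq_top, range_freeLift, hs])
  exact ⟨ι, inferInstance, d, p, hp, Projective.factorThru (𝟙 P) (freeLift p hp), hs,
    Projective.factorThru_comp _ _⟩

end GrMod

/-! ### Torsion and finite codimension. -/

namespace GrMod

variable {k : Type u} [Field k] {R : Type u} [Ring R] [Algebra k R]
variable {𝒜 : ℤ → Submodule k R}

/-- For homogeneous `t` the vectors `t a^n` lie in distinct degrees because `d ≠ 0`; if none
vanished they would be infinitely many independent vectors of `T`. For general `t` the exponents of
the components are added up. -/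
lemma exists_pow_smul_eq_zero [SetLike.GradedMonoid 𝒜] {M : GrMod 𝒜} {T : Submodule Rᵐᵒᵖ M}
    (hT : T ∈ M.torsion) {a : R} {d : ℤ} (ha : a ∈ 𝒜 d) (hd : d ≠ 0) {t : M} (ht : t ∈ T) :
    ∃ n : ℕ, op (a ^ n) • t = 0 := by
  classical
  have hfin := hT.2
  have key : ∀ i, ∃ n : ℕ, op (a ^ n) • (DirectSum.decompose M.component t i : M) = 0 := by
    intro i
    by_contra! h
    let v : ℕ → T := fun n => ⟨op (a ^ n) • (DirectSum.decompose M.component t i : M),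
      T.smul_mem _ (hT.1 i ht)⟩
    have hinj : Function.Injective fun n : ℕ => i + n • d := fun n l hnl => by
      have : n • d = l • d := add_left_cancel hnl
      simpa [hd] using this
    have hind := ((DirectSum.Decomposition.isInternal M.component).submodule_iSupIndep.comp
      hinj).linearIndependent _ (v := fun n => (v n : M)) (fun n => M.smul_mem (SetLike.coe_mem _)
        (SetLike.pow_mem_graded n ha)) h
    have hind' : LinearIndependent k v :=
      LinearIndependent.of_comp (T.subtype.restrictScalars k) hind
    exact not_finite_iff_infinite.2 inferInstance hind'.finite
  choose n hn using key
  set S := (DirectSum.decompose M.component t).support with hS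
  refine ⟨∑ i ∈ S, n i, ?_⟩
  rw [← DirectSum.sum_support_decompose M.component t, Finset.smul_sum, ← hS]
  refine Finset.sum_eq_zero fun i hi => ?_
  rw [← Finset.sum_erase_add _ _ hi, add_comm, pow_add, op_mul, mul_smul, hn, smul_zero]

lemma top_mem_torsion {M : GrMod 𝒜} (h : Module.Finite k M) : ⊤ ∈ M.torsion :=
  ⟨fun _ _ _ => trivial, Module.Finite.equiv
    ((Submodule.topEquiv (R := Rᵐᵒᵖ) (M := M)).symm.restrictScalars k)⟩

lemma exists_pow_smul_mem [SetLike.GradedMonoid 𝒜] {M : GrMod 𝒜} {D : Submodule Rᵐᵒᵖ M}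
    (hD : D ∈ M.cofinite) {a : R} {d : ℤ} (ha : a ∈ 𝒜 d) (hd : d ≠ 0) (p : M) :
    ∃ n : ℕ, op (a ^ n) • p ∈ D := by
  obtain ⟨n, hn⟩ := exists_pow_smul_eq_zero (M := M.quot D hD.1) (top_mem_torsion hD.2) ha hd
    (t := D.mkQ p) trivial
  exact ⟨n, (Submodule.Quotient.mk_eq_zero D).1 hn⟩

/-- The codimension of `f(D)` in the range of `f` is at most that of `D` in `M`, and the range has
finite codimension in `N`. -/
lemma map_mem_cofinite {M N : GrMod 𝒜} (f : M ⟶ N) (hf : LinearMap.range f.toLinearMap ∈ N.cofinite)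
    {D : Submodule Rᵐᵒᵖ M} (hD : D ∈ M.cofinite) : D.map f.toLinearMap ∈ N.cofinite := by
  refine ⟨?_, ?_⟩
  · rintro i _ ⟨m, hm, rfl⟩
    exact ⟨_, hD.1 i hm, f.map_decompose m i⟩
  · have := hD.2
    let F := D.mapQ (D.map f.toLinearMap) f.toLinearMap (Submodule.le_comap_map _ _)
    have : Module.Finite k (LinearMap.range F) :=
      Module.Finite.of_surjective (F.rangeRestrict.restrictScalars k) F.surjective_rangeRestrict
    refine finite_quotient_of_ker_le (LinearMap.range F) hf.2
      (((D.map f.toLinearMap).mkQ ∘ₗ (LinearMap.range f.toLinearMap).subtype).codRestrict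
        (LinearMap.range F) ?_) ?_
    · rintro ⟨_, m, rfl⟩
      exact ⟨D.mkQ m, rfl⟩
    · intro n hn
      exact (Submodule.Quotient.mk_eq_zero _).1 (congrArg Subtype.val hn)

end GrMod

/-! ### Images of representatives and epimorphisms of `qgr R`. -/

namespace QPreHom

variable {k : Type u} [Field k] {R : Type u} [Ring R] [Algebra k R]
variable {𝒜 : ℤ → Submodule k R} {M N L : GrMod 𝒜}

lemma Rel.add {φ : QPreHom M N} {m m' n n'} (h : φ.Rel m n) (h' : φ.Rel m' n') :
    φ.Rel (m + m') (n + n') := by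
  obtain ⟨h, e⟩ := h
  obtain ⟨h', e'⟩ := h'
  refine ⟨add_mem h h', ?_⟩
  rw [map_add, ← e, ← e', ← map_add]
  rfl

lemma Rel.smul {φ : QPreHom M N} {m n} (r : Rᵐᵒᵖ) (h : φ.Rel m n) :
    φ.Rel (r • m) (r • n) := by
  obtain ⟨h, e⟩ := h
  refine ⟨φ.dom.smul_mem r h, ?_⟩
  rw [map_smul, ← e, ← map_smul]
  rfl

lemma Rel.zero (φ : QPreHom M N) : φ.Rel 0 0 := ⟨zero_mem _, by
  rw [map_zero]
  exact map_zero φ.map⟩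

lemma Rel.sum {φ : QPreHom M N} {ι : Type u} [Fintype ι] {m : ι → M} {n : ι → N}
    (h : ∀ t, φ.Rel (m t) (n t)) (v : ι → R) :
    φ.Rel (∑ t, op (v t) • m t) (∑ t, op (v t) • n t) := by
  classical
  induction (Finset.univ : Finset ι) using Finset.induction_on with
  | empty => exact .zero φ
  | insert t T ht ih =>
    rw [Finset.sum_insert ht, Finset.sum_insert ht]
    exact ((h t).smul _).add ih

/-- The elements of `N` that represent images under `φ`. -/
def image (φ : QPreHom M N) : Submodule Rᵐᵒᵖ N where
  carrier := {n | ∃ m, φ.Rel m n}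
  add_mem' := fun ⟨_, h⟩ ⟨_, h'⟩ => ⟨_, h.add h'⟩
  zero_mem' := ⟨0, .zero φ⟩
  smul_mem' := fun r _ ⟨_, h⟩ => ⟨_, h.smul r⟩

lemma image_isHomogeneous (φ : QPreHom M N) : φ.image.IsHomogeneous N.component :=
  fun i _ ⟨_, h⟩ => ⟨_, h.proj i⟩

/-- The projection `N → N/image` and the zero map agree after precomposition with `φ`. As `φ` is epi
they agree in `qgr`, so the projection maps some submodule of finite codimension into a
finite-dimensional one. -/
lemma image_mem_cofinite (φ : QPreHom M N)
    (h : Epi (X := (⟨M⟩ : QGr 𝒜)) (Y := ⟨N⟩) (Quotient.mk _ φ)) : φ.image ∈ N.cofinite := by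
  refine ⟨φ.image_isHomogeneous, ?_⟩
  let C := N.quot φ.image φ.image_isHomogeneous
  let q : N ⟶ C := N.quotHom φ.image φ.image_isHomogeneous
  have h₁ : (qgrFunctor 𝒜).map q = (qgrFunctor 𝒜).map (zeroHom N C) := by
    refine h.left_cancellation (Z := (qgrFunctor 𝒜).obj C) _ _ (Quotient.sound ?_)
    refine equivalent_of φ.dom ⊥ φ.dom_mem (bot_mem_torsion _) fun m hm => ?_
    obtain ⟨n, hn⟩ := φ.exists_rel hm
    refine ⟨_, _, comp_rel hn (ofHom_rel _ n), comp_rel hn (ofHom_rel _ n), ?_⟩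
    have : q.toLinearMap n = (0 : C) := (Submodule.Quotient.mk_eq_zero φ.image).2 ⟨m, hn⟩
    exact (Submodule.mem_bot _).2 (sub_eq_zero.2 this)
  obtain ⟨D, hD, T, hT, h₂⟩ := Equivalent.exists_rel (Quotient.exact h₁)
  have h₃ : ∀ n : D, q.toLinearMap n ∈ T := by
    rintro ⟨n, hn⟩
    obtain ⟨a, b, ha, hb, hab⟩ := h₂ n hn
    rw [rel_ofHom ha, rel_ofHom hb] at hab
    simpa [zeroHom] using hab
  have := hT.2
  exact finite_quotient_of_ker_le T hD.2 ((q.toLinearMap ∘ₗ D.subtype).codRestrict T h₃)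
    fun n hn => (Submodule.Quotient.mk_eq_zero φ.image).1 (congrArg Subtype.val hn)

end QPreHom

/-! ### From `κ(P) = P` to projectivity of `πP`. -/

section Projective

variable {k : Type u} [Field k] {R : Type u} [Ring R] [Algebra k R]
variable {𝒜 : ℤ → Submodule k R}

/-- Two maps that agree after `f` on `D` agree, up to torsion, on `f(D)`, which still has finite
codimension. -/
lemma epi_map_of_range_mem_cofinite {M N : GrMod 𝒜} (f : M ⟶ N)
    (hf : LinearMap.range f.toLinearMap ∈ N.cofinite) : Epi ((qgrFunctor 𝒜).map f) := by
  refine ⟨fun {L} g h hgh => ?_⟩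
  obtain ⟨φ, rfl⟩ := Quotient.exists_rep g
  obtain ⟨ψ, rfl⟩ := Quotient.exists_rep h
  obtain ⟨D, hD, T, hT, h₁⟩ := Equivalent.exists_rel (Quotient.exact hgh)
  refine Quotient.sound (equivalent_of (D.map f.toLinearMap ⊓ (φ.dom ⊓ ψ.dom))
    (T ⊔ (compTor (ofHom f) φ ⊔ compTor (ofHom f) ψ))
    (cofinite_inf (map_mem_cofinite f hf hD) (cofinite_inf φ.dom_mem ψ.dom_mem))
    (torsion_sup hT (torsion_sup (compTor_mem _ _) (compTor_mem _ _))) ?_)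
  rintro _ ⟨⟨m, hm, rfl⟩, h₂, h₃⟩
  obtain ⟨a, ha⟩ := φ.exists_rel h₂
  obtain ⟨b, hb⟩ := ψ.exists_rel h₃
  obtain ⟨l, l', hl, hl', hll⟩ := h₁ m hm
  refine ⟨a, b, ha, hb, ?_⟩
  have : a - b = (l - l') + ((a - l) + (l' - b)) := by abel
  rw [this]
  exact Submodule.add_mem_sup hll (Submodule.add_mem_sup
    ((comp_rel (ofHom_rel f m) ha).sub_mem hl) (hl'.sub_mem (comp_rel (ofHom_rel f m) hb)))

/-- A projective graded module without finite-dimensional quotients is projective in the quotient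
category. -/
theorem projective_qgr_of_kappa_eq_top [GradedAlgebra 𝒜] (P : GrMod 𝒜) [Projective P]
    (h : P.kappa = ⊤) : Projective ((qgrFunctor 𝒜).obj P) := by
  have hD : ∀ D ∈ P.cofinite, D = ⊤ := fun D hD => top_le_iff.1 (h ▸ sInf_le hD)
  refine ⟨fun {M N} g e he => ?_⟩
  obtain ⟨φ, rfl⟩ := Quotient.exists_rep g
  obtain ⟨ε, rfl⟩ := Quotient.exists_rep e
  change QPreHom P N.of at φ
  have hS := ε.image_mem_cofinite he
  have key : ∀ i, ∀ p ∈ P.component i, ∃ m ∈ M.of.component i, ∃ n, ε.Rel m n ∧ φ.Rel p n := by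
    intro i p hp
    -- Only the domain of `θ` matters: `compDom φ θ` is the set of elements whose `φ`-image has a
    -- representative hit by `ε`. It has finite codimension, hence is all of `P`.
    let θ : QPreHom N.of N.of :=
      { dom := ε.image, tor := ⊥, dom_mem := hS, tor_mem := bot_mem_torsion _, map := 0
        map_mem := fun i m _ => ⟨0, zero_mem _, by simp⟩ }
    have hp' : p ∈ compDom φ θ := by rw [hD _ (compDom_mem φ θ)]; trivial
    obtain ⟨n, ⟨m, hm⟩, hn⟩ := (mem_compDom φ θ).1 hp'
    -- Passing to degree `i` fixes `p` and makes the lift `m` homogeneous, as `freeLift` requires.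
    have := hn.proj i
    rw [DirectSum.decompose_of_mem_same _ hp] at this
    exact ⟨_, SetLike.coe_mem _, _, hm.proj i, this⟩
  obtain ⟨ι, _, d, p, hp, s, hs, hsp⟩ := P.exists_retract_free
  choose m hm n hmn hpn using fun t => key (d t) (p t) (hp t)
  refine ⟨(qgrFunctor 𝒜).map (s ≫ freeLift m hm), Quotient.sound ?_⟩
  refine equivalent_of ⊤ ⊥ (top_mem_cofinite _) (bot_mem_torsion _) fun (q : P) _ => ?_
  have h₁ := Rel.sum hmn (s.toLinearMap q)
  have h₂ := Rel.sum hpn (s.toLinearMap q)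
  have hq : ∑ t, op ((s.toLinearMap q : ι → R) t) • p t = q :=
    LinearMap.congr_fun (congrArg Hom.toLinearMap hsp) q
  rw [hq] at h₂
  exact ⟨_, _, comp_rel (ofHom_rel _ q) h₁, h₂, by simp⟩

end Projective

/-! ### Extension of maps into `A(f)` from submodules of finite codimension. -/

namespace GWA

variable {k : Type u} [Field k] {f : k[X]}

lemma smul_eq_zero_of_free (hf : f ≠ 0) {ι : Type u} [Fintype ι] {d : ι → ℤ}
    {v : free (component f) ι d} {n : ℕ} (h : op (gen f .x ^ n) • v = 0) : v = 0 :=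
  funext fun t => eq_zero_of_mul_pow_eq_zero (eq_zero_of_mul_x_eq_zero hf) n _ (congrFun h t)

/-- Homomorphisms to `A(f)` extend along inclusions with finite-dimensional cokernel. -/
lemma exists_extension (hf : f ≠ 0) {P : GrMod (component f)} {D : Submodule (GWA f)ᵐᵒᵖ P}
    (hD : D ∈ P.cofinite) (φ : D →ₗ[(GWA f)ᵐᵒᵖ] GWA f) (d : ℤ)
    (hφ : ∀ i (p : D), (p : P) ∈ P.component i → φ p ∈ component f (i - d)) :
    ∃ ψ : P →ₗ[(GWA f)ᵐᵒᵖ] GWA f, ∀ p : D, ψ p = φ p := by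
  let x := gen f .x
  let y := gen f .y
  have hx := fun n a => eq_zero_of_mul_pow_eq_zero (eq_zero_of_mul_x_eq_zero hf) n a
  have hy := fun n a => eq_zero_of_mul_pow_eq_zero (eq_zero_of_mul_y_eq_zero hf) n a
  -- `G p a` says that `a` is the forced value `φ(p x^n) x^{-n}` of the extension at `p`. Cancelling
  -- `x` gives uniqueness, the Ore property linearity; the grading is needed only for existence.
  let G : P → GWA f → Prop := fun p a => ∃ n, ∃ h : op (x ^ n) • p ∈ D, φ ⟨_, h⟩ = a * x ^ n
  have hφs : ∀ (r : GWA f) {p q : P} (hp : p ∈ D) (hq : q ∈ D), q = op r • p →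
      φ ⟨q, hq⟩ = φ ⟨p, hp⟩ * r := by
    rintro r p _ hp hq rfl
    exact φ.map_smul (op r) ⟨p, hp⟩
  have hmono : ∀ {p a} n, ∀ h : op (x ^ n) • p ∈ D, φ ⟨_, h⟩ = a * x ^ n → ∀ l,
      ∃ h : op (x ^ (n + l)) • p ∈ D, φ ⟨_, h⟩ = a * x ^ (n + l) := by
    intro p a n h e l
    have h₁ : op (x ^ (n + l)) • p = op (x ^ l) • op (x ^ n) • p := by
      rw [pow_add, op_mul_smul]
    have h₂ : op (x ^ (n + l)) • p ∈ D := by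
      rw [h₁]
      exact D.smul_mem _ h
    exact ⟨h₂, by rw [hφs _ h h₂ h₁, e, mul_assoc, ← pow_add]⟩
  have hadd : ∀ {p q a b}, G p a → G q b → G (p + q) (a + b) := by
    rintro p q a b ⟨n, h, e⟩ ⟨l, h', e'⟩
    obtain ⟨h₁, e₁⟩ := hmono n h e l
    obtain ⟨h₂, e₂⟩ := hmono l h' e' n
    simp only [add_comm l n] at h₂ e₂
    have h₃ : op (x ^ (n + l)) • (p + q) ∈ D := by
      rw [smul_add]
      exact add_mem h₁ h₂
    refine ⟨n + l, h₃, ?_⟩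
    rw [add_mul, ← e₁, ← e₂, ← map_add]
    exact congrArg φ (Subtype.ext (smul_add _ _ _))
  have hsmul : ∀ (r : GWA f) {p a}, G p a → G (op r • p) (a * r) := by
    rintro r p a ⟨n, h, e⟩
    obtain ⟨l, r', hr⟩ := rightOre_x f r n
    have h₁ : op (x ^ l) • op r • p = op r' • op (x ^ n) • p := by
      rw [← op_mul_smul, ← op_mul_smul, hr]
    have h₂ : op (x ^ l) • op r • p ∈ D := by
      rw [h₁]
      exact D.smul_mem _ h
    exact ⟨l, h₂, by rw [hφs _ h h₂ h₁, e, mul_assoc, mul_assoc, hr]⟩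
  have huniq : ∀ {p a b}, G p a → G p b → a = b := by
    rintro p a b ⟨n, h, e⟩ ⟨l, h', e'⟩
    obtain ⟨h₁, e₁⟩ := hmono n h e l
    obtain ⟨h₂, e₂⟩ := hmono l h' e' n
    simp only [add_comm l n] at h₂ e₂
    refine sub_eq_zero.1 (hx (n + l) _ ?_)
    rw [sub_mul, ← e₁, ← e₂, sub_self]
  have hex : ∀ p, ∃ a, G p a := by
    intro p
    induction p using DirectSum.Decomposition.inductionOn P.component with
    | zero => exact ⟨0, 0, by simp, by
        rw [zero_mul, hφs 0 (zero_mem D) _ (by simp), mul_zero]⟩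
    | add p q hp hq =>
      obtain ⟨a, ha⟩ := hp
      obtain ⟨b, hb⟩ := hq
      exact ⟨_, hadd ha hb⟩
    | @homogeneous i p =>
      obtain ⟨n, hn⟩ := exists_pow_smul_mem hD (gen_mem f .x) (by decide) (p : P)
      -- The value sought has degree `i - d`. If this is `l ≥ 0`, then `φ(p x^n)` lies in `k[z]
      -- x^(l+n)` and is visibly divisible by `x^n`. If it is `-l`, the same argument works with `y`
      -- in place of `x`.
      rcases (i - d).eq_nat_or_neg with ⟨l, hl | hl⟩
      · have h := hφ (i + n) ⟨_, hn⟩ (by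
          simpa [GWAGen.deg] using P.smul_mem p.2 (SetLike.pow_mem_graded n (gen_mem f .x)))
        rw [show i + n - d = ((l + n : ℕ) : ℤ) by push_cast; omega] at h
        obtain ⟨q, hq⟩ := exists_aeval_mul_x_pow f h
        exact ⟨aeval (gen f .z) q * x ^ l, n, hn, by rw [hq, pow_add, mul_assoc]⟩
      · obtain ⟨j, hj⟩ := exists_pow_smul_mem hD (gen_mem f .y) (by decide) (p : P)
        have h := hφ (i - j) ⟨_, hj⟩ (by
          simpa [GWAGen.deg, sub_eq_add_neg] using
            P.smul_mem p.2 (SetLike.pow_mem_graded j (gen_mem f .y)))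
        rw [show i - j - d = -((l + j : ℕ) : ℤ) by push_cast; omega] at h
        obtain ⟨q, hq⟩ := exists_aeval_mul_y_pow f h
        refine ⟨aeval (gen f .z) q * y ^ l, n, hn, ?_⟩
        -- The value `a` found with `y` must satisfy the condition for `x`. With `x^n y^c = y^j r`,
        -- both `φ(p x^n) y^c` and `a x^n y^c` equal `φ(p y^j) r`, and `y^c` cancels.
        obtain ⟨c, r, hr⟩ := rightOre_y f (x ^ n) j
        refine sub_eq_zero.1 (hy c _ ?_)
        have h₁ : op (y ^ c) • op (x ^ n) • (p : P) = op r • op (y ^ j) • (p : P) := by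
          rw [← op_mul_smul, ← op_mul_smul, hr]
        have h₂ : op (y ^ c) • op (x ^ n) • (p : P) ∈ D := D.smul_mem _ hn
        rw [sub_mul, sub_eq_zero]
        change φ ⟨op (x ^ n) • (p : P), hn⟩ * y ^ c = _
        rw [← hφs _ hn h₂ rfl, hφs _ hj h₂ h₁, hq, mul_assoc _ (x ^ n), hr, pow_add]
        simp only [mul_assoc, y]
  choose ψ hψ using hex
  refine ⟨{ toFun := ψ, map_add' := fun p q => huniq (hψ _) (hadd (hψ p) (hψ q)),
            map_smul' := fun r p => huniq (hψ _) (hsmul r.unop (hψ p)) }, fun p => ?_⟩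
  refine huniq (hψ p) ⟨0, by simp, ?_⟩
  rw [hφs 1 p.2 _ (by simp)]
  simp

end GWA

/-! ### Description of `κ(P)` and the converse implication. -/

namespace GWA

variable {k : Type u} [Field k]

/-- `P` is a direct summand of a graded free module, where `x` cancels on the right. -/
lemma smul_eq_zero_of_projective {f : k[X]} (hf : f ≠ 0) (P : GrMod (component f)) [Projective P]
    {n : ℕ} {p : P} (h : op (gen f .x ^ n) • p = 0) : p = 0 := by
  obtain ⟨ι, _, d, q, hq, i, -, hi⟩ := P.exists_retract_free
  have h₁ : i.toLinearMap p = 0 := by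
    refine smul_eq_zero_of_free hf (n := n) ?_
    rw [← map_smul, h, map_zero]
  have h₂ : (freeLift q hq).toLinearMap (i.toLinearMap p) = p :=
    LinearMap.congr_fun (congrArg Hom.toLinearMap hi) p
  rw [← h₂, h₁, map_zero]

lemma torsion_eq_bot {f : k[X]} {M : GrMod (component f)}
    (hM : ∀ (n : ℕ) (p : M), op (gen f .x ^ n) • p = 0 → p = 0) {T : Submodule (GWA f)ᵐᵒᵖ M}
    (hT : T ∈ M.torsion) : T = ⊥ := by
  refine (Submodule.eq_bot_iff _).2 fun t ht => ?_
  obtain ⟨n, hn⟩ := exists_pow_smul_eq_zero hT (gen_mem f .x) (by decide) ht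
  exact hM n t hn

/-- If the image of a graded free module in `P` has finite codimension and `P` is projective in the
quotient category, then the free module maps onto `P`. -/
lemma range_eq_top_of_projective_qgr {f : k[X]} (hf : f ≠ 0) (P : GrMod (component f))
    [Projective P] (hP : Projective ((qgrFunctor (component f)).obj P))
    {ι : Type u} [Fintype ι] {d : ι → ℤ} (g : free (component f) ι d ⟶ P)
    (hg : LinearMap.range g.toLinearMap ∈ P.cofinite) : LinearMap.range g.toLinearMap = ⊤ := by
  have hPx : ∀ (n : ℕ) (p : P), op (gen f .x ^ n) • p = 0 → p = 0 := fun n p =>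
    smul_eq_zero_of_projective hf P
  have := epi_map_of_range_mem_cofinite g hg
  obtain ⟨s, hs⟩ := hP.factors (𝟙 _) ((qgrFunctor (component f)).map g)
  obtain ⟨σ, rfl⟩ := Quotient.exists_rep s
  change QPreHom P (free (component f) ι d) at σ
  obtain ⟨D, hD, T, hT, h⟩ := Equivalent.exists_rel
    (φ := σ.comp (ofHom g)) (ψ := ofHom (𝟙 P)) (Quotient.exact hs)
  -- The free module has no finite-dimensional graded submodules except zero, so the section `σ` is
  -- an honest map into it and can be extended coordinate by coordinate.
  have htor : σ.tor = ⊥ := torsion_eq_bot (fun n v => smul_eq_zero_of_free hf) σ.tor_mem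
  let φ : σ.dom →ₗ[(GWA f)ᵐᵒᵖ] (ι → GWA f) := (σ.tor.quotEquivOfEqBot htor).toLinearMap ∘ₗ σ.map
  have hφ : ∀ (p : σ.dom) (v : free (component f) ι d), σ.map p = σ.tor.mkQ v → φ p = v := by
    intro p v hv
    change σ.tor.quotEquivOfEqBot htor (σ.map p) = v
    rw [hv]
    rfl
  have hext : ∀ t, ∃ ψ : P →ₗ[(GWA f)ᵐᵒᵖ] GWA f, ∀ p : σ.dom, ψ p = φ p t := by
    intro t
    refine exists_extension hf σ.dom_mem (LinearMap.proj t ∘ₗ φ) (d t) fun i p hp => ?_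
    obtain ⟨v, hv, e⟩ := σ.map_mem i p hp
    rw [LinearMap.comp_apply, hφ p v e]
    exact hv t trivial
  choose ψ hψ using hext
  have key : ∀ p ∈ D ⊓ σ.dom, g.toLinearMap (LinearMap.pi ψ p : ι → GWA f) = p := by
    rintro p ⟨hp, hp'⟩
    obtain ⟨v, hv⟩ := σ.exists_rel hp'
    have hv' : (LinearMap.pi ψ p : ι → GWA f) = v := by
      rw [← hφ ⟨p, hp'⟩ v hv.2]
      exact funext fun t => hψ t ⟨p, hp'⟩
    obtain ⟨l, l', hl, hl', hT'⟩ := h p hp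
    rw [torsion_eq_bot hPx hT, Submodule.mem_bot, sub_eq_zero] at hT'
    have h₁ := (comp_rel hv (ofHom_rel g v)).sub_mem hl
    rw [torsion_eq_bot hPx (σ.comp (ofHom g)).tor_mem, Submodule.mem_bot, sub_eq_zero] at h₁
    rw [hv']
    exact h₁.trans (hT'.trans (rel_ofHom hl'))
  refine LinearMap.range_eq_top.2 fun p => ⟨(LinearMap.pi ψ p : ι → GWA f), ?_⟩
  -- Some `p x^n` lies where the extended map is known to be a section of `g`; absence of
  -- `x`-torsion in `P` carries the identity back to `p`.
  obtain ⟨n, hn⟩ := exists_pow_smul_mem (cofinite_inf hD σ.dom_mem) (gen_mem f .x) (by decide) p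
  refine sub_eq_zero.1 (hPx n _ ?_)
  rw [smul_sub, sub_eq_zero, ← key _ hn, map_smul]
  exact (map_smul g.toLinearMap _ _).symm

/-- `P/K` is a quotient of a finite direct sum of copies of `A/(x^n A + y^n A)`, one for each
generator. -/
lemma finite_quotient_of_smul_mem {f : k[X]} (hf : f ≠ 0) {P : GrMod (component f)} {ι : Type u}
    [Fintype ι] {p : ι → P} (hp : Submodule.span (GWA f)ᵐᵒᵖ (Set.range p) = ⊤) (n : ℕ)
    {K : Submodule (GWA f)ᵐᵒᵖ P} (hx : ∀ t, op (gen f .x ^ n) • p t ∈ K)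
    (hy : ∀ t, op (gen f .y ^ n) • p t ∈ K) : Module.Finite k (P ⧸ K) := by
  have := finite_quotient_span_pow hf n
  set J := Submodule.span (GWA f)ᵐᵒᵖ {gen f .x ^ n, gen f .y ^ n}
  let g : ι → GWA f →ₗ[(GWA f)ᵐᵒᵖ] P := fun t =>
    { toFun := fun r => op r • p t
      map_add' := fun r s => by rw [MulOpposite.op_add, add_smul]
      map_smul' := fun r s => by
        rw [RingHom.id_apply, smul_smul]
        rfl }
  have hJ : ∀ t, J ≤ K.comap (g t) := fun t => Submodule.span_le.2 (by
    rintro _ (rfl | rfl)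
    exacts [hx t, hy t])
  let F : (ι → GWA f ⧸ J) →ₗ[(GWA f)ᵐᵒᵖ] P ⧸ K := ∑ t, J.mapQ K (g t) (hJ t) ∘ₗ LinearMap.proj t
  refine Module.Finite.of_surjective (F.restrictScalars k) fun y => ?_
  obtain ⟨q, rfl⟩ := K.mkQ_surjective y
  obtain ⟨c, rfl⟩ := (Submodule.mem_span_range_iff_exists_fun _).1 (hp ▸ Submodule.mem_top (x := q))
  refine ⟨fun t => J.mkQ (c t).unop, ?_⟩
  change F _ = _
  rw [map_sum, LinearMap.sum_apply]
  rfl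

variable [CharZero k]

/-- The smallest graded submodule of finite codimension is the image of a graded free module. -/
lemma exists_freeLift_range_least (m : ℕ) (P : GrMod (component (poly k m))) :
    ∃ (ι : Type u) (_ : Fintype ι) (d : ι → ℤ) (g : free (component (poly k m)) ι d ⟶ P),
      IsLeast P.cofinite (LinearMap.range g.toLinearMap) := by
  obtain ⟨ι, _, d, p, hp, hs⟩ := P.exists_homogeneous_generators
  let x := gen (poly k m) .x
  let y := gen (poly k m) .y
  let q : ι ⊕ ι → P := Sum.elim (fun t => op (x ^ m) • p t) (fun t => op (y ^ m) • p t)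
  have hq : ∀ t, q t ∈ P.component (Sum.elim (fun t => d t + m) (fun t => d t - m) t) := by
    rintro (t | t)
    · simpa [GWAGen.deg, q, x] using
        P.smul_mem (hp t) (SetLike.pow_mem_graded m (gen_mem (poly k m) .x))
    · simpa [GWAGen.deg, q, y, sub_eq_add_neg] using
        P.smul_mem (hp t) (SetLike.pow_mem_graded m (gen_mem (poly k m) .y))
  refine ⟨ι ⊕ ι, inferInstance, _, freeLift q hq, ⟨Hom.range_isHomogeneous _, ?_⟩, fun D hD => ?_⟩
  · rw [range_freeLift]
    exact finite_quotient_of_smul_mem (poly_ne_zero m) hs m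
      (fun t => Submodule.subset_span ⟨Sum.inl t, rfl⟩)
      (fun t => Submodule.subset_span ⟨Sum.inr t, rfl⟩)
  -- Minimality: `x` and `y` act locally nilpotently on `P/D`, so their `m`-th powers act as zero
  -- there and `D` contains every `p t x^m` and `p t y^m`.
  · have hx : ∀ v : P ⧸ D, ∃ n, op (x ^ n) • v = 0 := fun v => by
      obtain ⟨v, rfl⟩ := D.mkQ_surjective v
      obtain ⟨n, hn⟩ := exists_pow_smul_mem hD (gen_mem (poly k m) .x) (by decide) v
      exact ⟨n, (Submodule.Quotient.mk_eq_zero D).2 hn⟩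
    have hy : ∀ v : P ⧸ D, ∃ n, op (y ^ n) • v = 0 := fun v => by
      obtain ⟨v, rfl⟩ := D.mkQ_surjective v
      obtain ⟨n, hn⟩ := exists_pow_smul_mem hD (gen_mem (poly k m) .y) (by decide) v
      exact ⟨n, (Submodule.Quotient.mk_eq_zero D).2 hn⟩
    rw [range_freeLift]
    refine Submodule.span_le.2 ?_
    rintro _ ⟨t | t, rfl⟩
    · exact (Submodule.Quotient.mk_eq_zero D).1 (op_x_pow_smul_eq_zero hx hy (D.mkQ (p t)))
    · exact (Submodule.Quotient.mk_eq_zero D).1 (op_y_pow_smul_eq_zero hx hy (D.mkQ (p t)))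

end GWA

theorem mainTheorem11 {k : Type u} [Field k] [IsAlgClosed k] [CharZero k] (m : ℕ) (hm : 0 < m)
    (P : GrMod (GWA.component (X * (X + C (m : k))))) (hP : CategoryTheory.Projective P) :
    IsLeast P.cofinite P.kappa ∧
      (CategoryTheory.Projective ((qgrFunctor (GWA.component (X * (X + C (m : k))))).obj P) ↔
        P.kappa = ⊤) := by
  obtain ⟨ι, _, d, g, hg⟩ := GWA.exists_freeLift_range_least m P
  have hk : P.kappa = LinearMap.range g.toLinearMap := hg.isGLB.sInf_eq
  refine ⟨hk ▸ hg, fun h => ?_, fun h => projective_qgr_of_kappa_eq_top P h⟩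
  rw [hk]
  exact GWA.range_eq_top_of_projective_qgr (GWA.poly_ne_zero m) P h g hg.1
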